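/- Let $E$ and $B$ be connected (Hausdorff, second countable) smooth manifolds, let $F$ be a connected complex manifold, and let $\pi\colon E\to B$ be a smooth locally trivial fibration with fiber $F$. Let $\mathcal F$ be a smooth transversely holomorphic foliation on $E$, that is, a foliation given by smooth distinguished charts $(x,y)$ with values in $\mathbb R^p\times\mathbb C^q$ whose changes of charts act on the transverse coordinate $y$ by local holomorphic maps $y'=g(y)$. Suppose that $\mathcal F$ is transverse to the fibration: (1) at every point, the leaf is transverse to the fiber of $\pi$; (2) $\dim\mathcal F+\dim_{\mathbb R} F=\dim E$; (3) for each leaf $L$ of $\mathcal F$ (with its leaf topology) the restriction $\pi|_L\colon L\to B$ is a covering map. Let $\Omega(\mathcal F)\subset E$ be the union of the compact leaves of $\mathcal F$. Suppose that $\tilde\mu(\Omega(\mathcal F))>0$ for some regular volume measure $\tilde\mu$ on $E$, i.e. a Borel measure that has, in every chart of $E$, a continuous strictly positive density with respect to Lebesgue measure. Then $\mathcal F$ is a Seifert fibration, that is, every leaf of $\mathcal F$ is compact and has a finite holonomy group; and the global holonomy group of $\mathcal F$ is finite, that is, for every $b\in B$ the representation of $\pi_1(B,b)$ in the group of bijections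 of $F_b=\pi^{-1}(b)$, obtained by lifting loops at $b$ to the leaves through the covering maps $\pi|_L$, has finite image. -/

import Mathlib

open scoped Manifold ContDiff Topology
open Set

/-- A (smooth) transversely holomorphic foliation of leaf dimension `p` and complex codimension `q`
on the smooth `N`-manifold `E`, given by an atlas of distinguished charts. A distinguished chart is
a diffeomorphism of an open set of `E` onto (ball of `ℝᵖ`) × (ball of `ℂ^q`), and the changes of
distinguished charts act on the transverse coordinate by local holomorphic maps
`y' = g y` depending on `y` only. -/
structure TransHolFoliation (p q N : ℕ) (E : Type*) [TopologicalSpace E]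
    [ChartedSpace (EuclideanSpace ℝ (Fin N)) E] where
  /-- the distinguished charts -/
  atlas : Set (OpenPartialHomeomorph E (EuclideanSpace ℝ (Fin p) × EuclideanSpace ℂ (Fin q)))
  covers : ∀ x : E, ∃ φ ∈ atlas, x ∈ φ.source
  target_eq : ∀ φ ∈ atlas, ∃ (a : EuclideanSpace ℝ (Fin p)) (r : ℝ)
    (c : EuclideanSpace ℂ (Fin q)) (s : ℝ), φ.target = Metric.ball a r ×ˢ Metric.ball c s
  smooth : ∀ φ ∈ atlas, ContMDiffOn (𝓡 N)
    𝓘(ℝ, EuclideanSpace ℝ (Fin p) × EuclideanSpace ℂ (Fin q)) ∞ φ φ.source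
  smooth_symm : ∀ φ ∈ atlas, ContMDiffOn
    𝓘(ℝ, EuclideanSpace ℝ (Fin p) × EuclideanSpace ℂ (Fin q)) (𝓡 N) ∞ φ.symm φ.target
  holomorphic : ∀ φ ∈ atlas, ∀ ψ ∈ atlas, ∀ z ∈ φ.source ∩ ψ.source,
    ∃ g : EuclideanSpace ℂ (Fin q) → EuclideanSpace ℂ (Fin q),
      AnalyticAt ℂ g (φ z).2 ∧ ∀ᶠ w in 𝓝 z, (ψ w).2 = g (φ w).2

namespace TransHolFoliation

variable {p q N : ℕ} {E : Type*} [TopologicalSpace E] [ChartedSpace (EuclideanSpace ℝ (Fin N)) E]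

/-- Two points lie on a common plaque (a set `y = const` in a distinguished chart). -/
def SamePlaque (𝓕 : TransHolFoliation p q N E) (x y : E) : Prop :=
  ∃ φ ∈ 𝓕.atlas, x ∈ φ.source ∧ y ∈ φ.source ∧ (φ x).2 = (φ y).2

/-- The leaf through `x`: all points joined to `x` by a finite chain of plaques. -/
def leaf (𝓕 : TransHolFoliation p q N E) (x : E) : Set E :=
  {y | Relation.EqvGen 𝓕.SamePlaque x y}

/-- The set `E` equipped with the leaf topology (the disjoint union of the leaves). -/
def LeafSpace (_𝓕 : TransHolFoliation p q N E) : Type _ := E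

/-- The leaf topology: it is generated by the relatively open subsets of the plaques. -/
noncomputable instance (𝓕 : TransHolFoliation p q N E) : TopologicalSpace 𝓕.LeafSpace :=
  TopologicalSpace.generateFrom
    {S : Set E | ∃ φ ∈ 𝓕.atlas, ∃ W : Set (EuclideanSpace ℝ (Fin p)), IsOpen W ∧
      ∃ y : EuclideanSpace ℂ (Fin q), S = φ.source ∩ φ ⁻¹' (W ×ˢ {y})}

/-- The identity map from `E` with the leaf topology to `E`. -/
def LeafSpace.toSpace {𝓕 : TransHolFoliation p q N E} (x : 𝓕.LeafSpace) : E := x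

/-- The leaf through `x` as a space of its own, with its leaf (not subspace) topology. -/
abbrev Leaf (𝓕 : TransHolFoliation p q N E) (x : E) : Type _ :=
  {y : 𝓕.LeafSpace // y.toSpace ∈ 𝓕.leaf x}

/-- The union of the compact leaves. -/
def compactLeaves (𝓕 : TransHolFoliation p q N E) : Set E :=
  {x | CompactSpace (𝓕.Leaf x)}

/-- The change of transverse coordinate from the chart `φ` to the chart `ψ` near the point `z`
(only its germ at `(φ z).2` matters). -/
noncomputable def transition
    (φ ψ : OpenPartialHomeomorph E (EuclideanSpace ℝ (Fin p) × EuclideanSpace ℂ (Fin q)))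
    (z : E) (y : EuclideanSpace ℂ (Fin q)) : EuclideanSpace ℂ (Fin q) :=
  (ψ (φ.symm ((φ z).1, y))).2

/-- `𝓕.HolonomyTransport φ x ψ z f`: the map `f`, from the transverse coordinate of `φ` near
`(φ x).2` to the transverse coordinate of `ψ` near `(ψ z).2`, is the holonomy transport along some
chain of plaques from `x` to `z`, i.e. the composite of the successive changes of transverse
coordinate along the chain. -/
inductive HolonomyTransport (𝓕 : TransHolFoliation p q N E)
    (φ : OpenPartialHomeomorph E (EuclideanSpace ℝ (Fin p) × EuclideanSpace ℂ (Fin q))) (x : E) :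
    OpenPartialHomeomorph E (EuclideanSpace ℝ (Fin p) × EuclideanSpace ℂ (Fin q)) → E →
      (EuclideanSpace ℂ (Fin q) → EuclideanSpace ℂ (Fin q)) → Prop
  | refl : φ ∈ 𝓕.atlas → x ∈ φ.source → HolonomyTransport 𝓕 φ x φ x id
  | plaque {ψ z f} (z' : E) : HolonomyTransport 𝓕 φ x ψ z f → z' ∈ ψ.source →
      (ψ z').2 = (ψ z).2 → HolonomyTransport 𝓕 φ x ψ z' f
  | change {ψ z f} (χ : OpenPartialHomeomorph E
        (EuclideanSpace ℝ (Fin p) × EuclideanSpace ℂ (Fin q))) :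
      HolonomyTransport 𝓕 φ x ψ z f → χ ∈ 𝓕.atlas → z ∈ χ.source →
      HolonomyTransport 𝓕 φ x χ z (transition ψ χ z ∘ f)

/-- The holonomy group of the leaf through `x`, represented (as a set of germs) on the transversal
through `x` given by the transverse coordinate of the distinguished chart `φ`: the germs at
`(φ x).2` of the holonomy transports along closed chains of plaques based at `x`. -/
def holonomyGroup (𝓕 : TransHolFoliation p q N E)
    (φ : OpenPartialHomeomorph E (EuclideanSpace ℝ (Fin p) × EuclideanSpace ℂ (Fin q))) (x : E) :
    Set (Filter.Germ (𝓝 (φ x).2) (EuclideanSpace ℂ (Fin q))) :=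
  {g | ∃ f : EuclideanSpace ℂ (Fin q) → EuclideanSpace ℂ (Fin q),
    𝓕.HolonomyTransport φ x φ x f ∧ g = (f : Filter.Germ (𝓝 (φ x).2) (EuclideanSpace ℂ (Fin q)))}

/-- A Seifert fibration: all leaves are compact with finite holonomy group. -/
def IsSeifertFibration (𝓕 : TransHolFoliation p q N E) : Prop :=
  ∀ x : E, CompactSpace (𝓕.Leaf x) ∧
    ∀ φ ∈ 𝓕.atlas, x ∈ φ.source → (𝓕.holonomyGroup φ x).Finite

/-- The tangent space at `x` of the leaf through `x`, computed in a distinguished chart `φ`. -/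
noncomputable def leafTangent
    (φ : OpenPartialHomeomorph E (EuclideanSpace ℝ (Fin p) × EuclideanSpace ℂ (Fin q))) (x : E) :
    Submodule ℝ (TangentSpace (𝓡 N) x) :=
  LinearMap.ker (mfderiv (𝓡 N) 𝓘(ℝ, EuclideanSpace ℂ (Fin q)) (fun w => (φ w).2) x).toLinearMap

/-- `𝓕` is transverse to the fibration `π : E → B` whose fiber has complex dimension `k`:
(1) leaves are transverse to fibers; (2) `dim 𝓕 + dim_ℝ F = dim E`;
(3) `π` restricts to a covering map on every leaf. -/
structure IsTransverseTo {B : Type*} [TopologicalSpace B] (𝓕 : TransHolFoliation p q N E) (m : ℕ)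
    [ChartedSpace (EuclideanSpace ℝ (Fin m)) B] (k : ℕ) (π : E → B) : Prop where
  transverse : ∀ x : E, ∀ φ ∈ 𝓕.atlas, x ∈ φ.source →
    leafTangent (N := N) φ x ⊔ LinearMap.ker (mfderiv (𝓡 N) (𝓡 m) π x).toLinearMap = ⊤
  dim_add : p + 2 * k = N
  covering : ∀ x : E, IsCoveringMap (fun y : 𝓕.Leaf x => π y.1.toSpace)

section GlobalHolonomy

variable {m k : ℕ} {B : Type*} [TopologicalSpace B] [ChartedSpace (EuclideanSpace ℝ (Fin m)) B]
  {𝓕 : TransHolFoliation p q N E} {π : E → B}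

/-- Global holonomy along a homotopy class `γ` of loops at `b`, as a self-map of the fiber over `b`:
the point `x` is sent to the end point of the lift of `γ` starting at `x` with respect to the
covering map `π|L : L → B`, where `L` is the leaf through `x`. -/
noncomputable def IsTransverseTo.transport (h : 𝓕.IsTransverseTo m k π) {b : B}
    (γ : FundamentalGroup B b) (x : π ⁻¹' {b}) : π ⁻¹' {b} :=
  let y := (h.covering x.1).monodromy γ ⟨⟨x.1, Relation.EqvGen.refl _⟩, x.2⟩
  ⟨y.1.1.toSpace, y.2⟩

theorem leaf_eq_of_mem {x y : E} (h : y ∈ 𝓕.leaf x) : 𝓕.leaf y = 𝓕.leaf x :=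
  Set.ext fun _ => ⟨fun h' => h.trans _ _ _ h', fun h' => (h.symm).trans _ _ _ h'⟩

/-- The monodromy of a leaf does not depend on the point used to name the leaf. -/
theorem monodromy_congr {S T : Set E} (hST : S = T)
    (hS : IsCoveringMap (fun y : {y : 𝓕.LeafSpace // y.toSpace ∈ S} => π y.1.toSpace))
    (hT : IsCoveringMap (fun y : {y : 𝓕.LeafSpace // y.toSpace ∈ T} => π y.1.toSpace))
    {b : B} (γ : FundamentalGroup B b) (x : 𝓕.LeafSpace) (hxS : x.toSpace ∈ S)
    (hxT : x.toSpace ∈ T) (hx : π x.toSpace = b) :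
    (hS.monodromy γ ⟨⟨x, hxS⟩, hx⟩).1.1 = (hT.monodromy γ ⟨⟨x, hxT⟩, hx⟩).1.1 := by
  subst hST
  rfl

/-- The global holonomy representation `π₁(B, b) → Bij(F_b)` of the fundamental group of the base
in the group of (automatically holomorphic) bijections of the fiber `F_b` over `b`. -/
noncomputable def IsTransverseTo.globalHolonomyHom (h : 𝓕.IsTransverseTo m k π) (b : B) :
    FundamentalGroup B b →* Equiv.Perm (π ⁻¹' {b}) :=
  MonoidHom.toHomPerm
    { toFun := fun γ => (h.transport γ : Function.End (π ⁻¹' {b}))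
      map_one' := by
        funext x
        apply Subtype.ext
        exact congrArg (fun y => y.1.1.toSpace)
          (congrFun ((h.covering x.1).monodromy_refl (x := b)) ⟨⟨x.1, Relation.EqvGen.refl _⟩, x.2⟩)
      map_mul' := by
        intro γ δ
        funext x
        apply Subtype.ext
        have h₁ := (h.covering x.1).monodromy_trans_apply δ γ
          ⟨⟨x.1, Relation.EqvGen.refl _⟩, x.2⟩
        refine (congrArg (fun y => y.1.1.toSpace) h₁).trans ?_
        have hz := ((h.covering x.1).monodromy δ ⟨⟨x.1, Relation.EqvGen.refl _⟩, x.2⟩).1.2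
        exact monodromy_congr (leaf_eq_of_mem hz).symm (h.covering x.1)
          (h.covering (h.transport δ x).1) γ _ hz (Relation.EqvGen.refl _) (h.transport δ x).2 }

/-- The global holonomy group of `𝓕` at `b`: the image of the global holonomy representation. -/
noncomputable def IsTransverseTo.globalHolonomy (h : 𝓕.IsTransverseTo m k π) (b : B) :
    Subgroup (Equiv.Perm (π ⁻¹' {b})) :=
  (h.globalHolonomyHom b).range

end GlobalHolonomy

end TransHolFoliation

/-- `π : E → B` is a smooth locally trivial fibration with fiber `F` (a complex manifold, regarded
here as a smooth real manifold). -/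
def IsSmoothFibration (N m k : ℕ) {E B : Type*} (F : Type*)
    [TopologicalSpace E] [ChartedSpace (EuclideanSpace ℝ (Fin N)) E]
    [TopologicalSpace B] [ChartedSpace (EuclideanSpace ℝ (Fin m)) B]
    [TopologicalSpace F] [ChartedSpace (EuclideanSpace ℂ (Fin k)) F] (π : E → B) : Prop :=
  ∀ b : B, ∃ e : Bundle.Trivialization F π, b ∈ e.baseSet ∧
    ContMDiffOn (𝓡 N) ((𝓡 m).prod 𝓘(ℝ, EuclideanSpace ℂ (Fin k))) ∞ e e.source ∧
    ContMDiffOn ((𝓡 m).prod 𝓘(ℝ, EuclideanSpace ℂ (Fin k))) (𝓡 N) ∞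
      e.toOpenPartialHomeomorph.symm e.target

/-- A volume measure on the smooth manifold `E`: in every chart it has a continuous, strictly
positive density with respect to Lebesgue measure. -/
def IsVolumeMeasure (N : ℕ) {E : Type*} [TopologicalSpace E]
    [ChartedSpace (EuclideanSpace ℝ (Fin N)) E] [MeasurableSpace E]
    (μ : MeasureTheory.Measure E) : Prop :=
  ∀ e ∈ atlas (EuclideanSpace ℝ (Fin N)) E, ∃ ρ : EuclideanSpace ℝ (Fin N) → ℝ,
    ContinuousOn ρ e.target ∧ (∀ y ∈ e.target, 0 < ρ y) ∧
    ∀ s ⊆ e.source, MeasurableSet s → μ s = ∫⁻ y in e '' s, ENNReal.ofReal (ρ y)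

/-!
A loop `γ` of the base `B` at `b` acts on the fiber `F_b` by lifting it to the leaves. As the leaves
are transverse to the fibers and of complementary dimension, the projection `π` and the transverse
coordinate of a foliation chart are together local coordinates of `E`
(`IsTransverseTo.exists_box`). In such a box the lifts of paths keep the transverse coordinate, so
that, by subdivision of the path, each transport between fibers is continuous, and holomorphic in
transverse coordinates (`IsTransverseTo.holAt_parallel`).

If a leaf `L` is compact, then so is `B`, and the fibers of `L → B` are finite. Hence the stabilizer
in `π₁(B, b)` of a point of `F_b` on a compact leaf has finite index. The fundamental group of
a compact manifold is finitely generated (`FundamentalGroup.fg_of_compactSpace`), and so it has only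
countably many subgroups of finite index (`Group.countable_finiteIndex_subgroup`). In a box, the
compact leaves are given by a set of transverse coordinates which is not null, since otherwise their
union would be null in `E` (`measure_transverse_preimage_eq_zero`). By countable additivity, some
subgroup `H` of finite index fixes a set of points of `F_b` that is not null in the transverse
coordinate. An analytic map that is the identity on a non-null set is the identity on some open set
(`AnalyticOnNhd.exists_eventuallyEq_zero_of_measure_ne_zero`), and `F_b` is connected. By analytic
continuation, `H` acts trivially on `F_b` (`eq_self_of_eventually_eq_self`), and the global holonomy
group at `b` is finite. By conjugation with a transport map it is finite at each point.

A leaf meets a fiber in an orbit of the global holonomy, which is finite, and so it is compact as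
a finite covering of the compact space `B`. Finally, holonomy transport along a closed chain of
plaques is the transport along a loop of the base, read in the transverse coordinate
(`HolonomyTransport.exists_parallel`). So the germs in the holonomy group of a leaf are determined
by elements of a finite group.
-/

universe u

/-! ### Zeros of analytic maps -/

open MeasureTheory in
/-- A differentiable map that vanishes on a set has zero derivative at almost every point of this
set, namely at its density points. -/
theorem ae_fderiv_eq_zero_of_eqOn_zero {V W : Type*} [NormedAddCommGroup V] [NormedSpace ℝ V]
    [FiniteDimensional ℝ V] [MeasurableSpace V] [BorelSpace V] (ν : Measure V) [ν.IsAddHaarMeasure]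
    [NormedAddCommGroup W] [NormedSpace ℝ W] [FiniteDimensional ℝ W] {g : V → W} {Z : Set V}
    (hZ : MeasurableSet Z) (hg : ∀ x ∈ Z, DifferentiableAt ℝ g x) (h0 : ∀ x ∈ Z, g x = 0) :
    ∀ᵐ x ∂ν.restrict Z, fderiv ℝ g x = 0 := by
  rcases subsingleton_or_nontrivial V with hV | hV
  · exact Filter.Eventually.of_forall fun x => Subsingleton.elim _ _
  obtain ⟨e, he⟩ := exists_ne (0 : V)
  let b := Module.finBasis ℝ W
  have key : ∀ i, ∀ᵐ x ∂ν.restrict Z,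
      ((LinearMap.toContinuousLinearMap (b.coord i)).comp (fderiv ℝ g x)).smulRight e = 0 := by
    intro i
    -- the derivative estimate is available for self-maps only, so use coordinates of `W` times `e`
    set l : W →L[ℝ] ℝ := LinearMap.toContinuousLinearMap (b.coord i)
    have h := ApproximatesLinearOn.norm_fderiv_sub_le (s := Z) (A := 0) (δ := 0) ν
      (f := fun x => l (g x) • e) (by
        intro x hx y hy
        simp [h0 x hx, h0 y hy]) hZ (fun x => (l.comp (fderiv ℝ g x)).smulRight e) (by
        intro x hx
        exact ((l.hasFDerivAt.comp x (hg x hx).hasFDerivAt).smul_const e).hasFDerivWithinAt)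
    filter_upwards [h] with x hx
    exact nnnorm_eq_zero.1 (le_antisymm (by simpa only [sub_zero] using hx) bot_le)
  rw [← ae_all_iff] at key
  filter_upwards [key] with x hx
  ext v
  refine b.ext_elem fun i => ?_
  have := congrArg (fun L : V →L[ℝ] V => L v) (hx i)
  simpa [he] using this

open MeasureTheory in
theorem ae_iteratedFDeriv_eq_zero_of_eqOn_zero {V : Type u} [NormedAddCommGroup V] [NormedSpace ℝ V]
    [FiniteDimensional ℝ V] [MeasurableSpace V] [BorelSpace V] (ν : Measure V) [ν.IsAddHaarMeasure]
    {U : Set V} (n : ℕ) :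
    ∀ {W : Type u} [NormedAddCommGroup W] [NormedSpace ℝ W] [FiniteDimensional ℝ W]
    {g : V → W} {Z : Set V}, MeasurableSet Z → Z ⊆ U → AnalyticOnNhd ℝ g U → (∀ x ∈ Z, g x = 0) →
    ∀ᵐ x ∂ν.restrict Z, iteratedFDeriv ℝ n g x = 0 := by
  induction n with
  | zero =>
    intro W _ _ _ g Z hZ hZU hg h0
    filter_upwards [ae_restrict_mem hZ] with x hx
    ext v
    simp [h0 x hx]
  | succ n ih =>
    intro W _ _ _ g Z hZ hZU hg h0
    have h1 := ae_fderiv_eq_zero_of_eqOn_zero ν hZ (fun x hx => (hg x (hZU hx)).differentiableAt) h0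
    have hm : MeasurableSet {x | fderiv ℝ g x = 0} :=
      measurable_fderiv ℝ g (measurableSet_singleton 0)
    have h2 := ih (g := fderiv ℝ g) (hZ.inter hm) (inter_subset_left.trans hZU) hg.fderiv
      (fun x hx => hx.2)
    rw [ae_restrict_iff' hZ] at h1 ⊢
    rw [ae_restrict_iff' (hZ.inter hm)] at h2
    filter_upwards [h1, h2] with x h1 h2 hx
    rw [iteratedFDeriv_succ_eq_comp_right, Function.comp_apply, h2 ⟨hx, h1 hx⟩]
    exact LinearIsometryEquiv.map_zero _

open MeasureTheory in
/-- A real analytic map that vanishes on a non-null set vanishes on a nonempty open set: almost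
every point of the zero set is a zero of all the derivatives, and the Taylor series at such a point
is zero. -/
theorem AnalyticOnNhd.exists_eventuallyEq_zero_of_measure_ne_zero
    {V W : Type u} [NormedAddCommGroup V] [NormedSpace ℝ V]
    [FiniteDimensional ℝ V] [MeasurableSpace V] [BorelSpace V] (ν : Measure V) [ν.IsAddHaarMeasure]
    [NormedAddCommGroup W] [NormedSpace ℝ W] [FiniteDimensional ℝ W] {g : V → W} {U : Set V}
    (hg : AnalyticOnNhd ℝ g U) (hU : IsOpen U) (hpos : ν {x ∈ U | g x = 0} ≠ 0) :
    ∃ x ∈ U, ∀ᶠ y in 𝓝 x, g y = 0 := by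
  set Z : Set V := {x ∈ U | g x = 0} with hZdef
  have hZ : MeasurableSet Z := by
    have : Z = U \ (U ∩ g ⁻¹' {0}ᶜ) := by ext x; simp [hZdef]
    rw [this]
    exact hU.measurableSet.diff
      (hg.continuousOn.isOpen_inter_preimage hU isOpen_compl_singleton).measurableSet
  have h := ae_all_iff.2 fun n => ae_iteratedFDeriv_eq_zero_of_eqOn_zero ν (U := U) n hZ
    (fun x hx => hx.1) hg (fun x hx => hx.2)
  rw [ae_restrict_iff' hZ] at h
  obtain ⟨x, hxZ, hx⟩ : ∃ x ∈ Z, ∀ n, iteratedFDeriv ℝ n g x = 0 := by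
    by_contra! hcon
    refine hpos (measure_mono_null ?_ h)
    intro x hx
    obtain ⟨n, hn⟩ := hcon x hx
    exact fun h' => hn (h' hx n)
  refine ⟨x, hxZ.1, ?_⟩
  obtain ⟨p, r, hp⟩ := hg x hxZ.1
  filter_upwards [Metric.eball_mem_nhds x hp.r_pos] with y hy
  have hy' : y - x ∈ Metric.eball (0 : V) r := by
    simpa [edist_eq_enorm_sub] using hy
  have hs := hp.hasSum_iteratedFDeriv hy'
  simp only [hx, add_sub_cancel] at hs
  simpa using hs.unique (by simp)

/-! ### Countability, subdivision and finite coverings -/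

/-- A finitely generated group is countable, and its subgroups of finite index are finitely
generated by Schreier's lemma, so that there are only countably many of them. -/
theorem Group.countable_finiteIndex_subgroup (G : Type*) [Group G] [Group.FG G] :
    {H : Subgroup G | H.FiniteIndex}.Countable := by
  have hc : Countable G := by
    obtain ⟨S, hS, φ, hφ⟩ := Group.fg_iff_exists_freeGroup_hom_surjective.1 ‹Group.FG G›
    have : Countable S := hS.countable
    have : Countable (FreeGroup S) := Quot.mk_surjective.countable
    exact hφ.countable
  refine (Set.countable_range fun S : Finset G => Subgroup.closure (S : Set G)).mono ?_
  intro H hH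
  have : H.FiniteIndex := hH
  obtain ⟨S, hS⟩ := (Group.fg_iff_subgroup_fg H).1 (inferInstance : Group.FG H)
  exact ⟨S, hS⟩

open unitInterval in
/-- Induction along the unit interval: a relation that is transitive along increasing triples and
holds for all sufficiently short intervals around each point holds for the endpoints. -/
theorem unitInterval.rel_zero_one_of_local {R : I → I → Prop}
    (trans : ∀ r s t, r ≤ s → s ≤ t → R r s → R s t → R r t)
    (loc : ∀ u, ∃ V ∈ 𝓝 u, ∀ s t, s ≤ t → Icc s t ⊆ V → R s t) : R 0 1 := by
  choose V hV hR using loc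
  obtain ⟨t, t0, tmono, ⟨n, hn⟩, hsub⟩ := exists_monotone_Icc_subset_open_cover_unitInterval
    (c := fun u => interior (V u)) (fun u => isOpen_interior)
    (fun u _ => mem_iUnion.2 ⟨u, mem_interior_iff_mem_nhds.2 (hV u)⟩)
  have step : ∀ k, R (t k) (t (k + 1)) := by
    intro k
    obtain ⟨u, hu⟩ := hsub k
    exact hR u _ _ (tmono k.le_succ) (hu.trans interior_subset)
  have key : ∀ k, R (t 0) (t (k + 1)) := by
    intro k
    induction k with
    | zero => exact step 0
    | succ k ih => exact trans _ _ _ (tmono (Nat.zero_le _)) (tmono (Nat.le_succ _)) ih (step _)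
  have := key n
  rwa [t0, hn (n + 1) n.le_succ] at this

/-- A covering space of a compact space is compact if its fibers are finite. -/
theorem IsCoveringMap.compactSpace_of_finite_fibers {X Y : Type*} [TopologicalSpace X]
    [TopologicalSpace Y] [CompactSpace Y] {f : X → Y} (hf : IsCoveringMap f)
    (hfin : ∀ y, (f ⁻¹' {y}).Finite) : CompactSpace X := by
  classical
  refine ⟨isCompact_iff_ultrafilter_le_nhds.2 fun 𝒰 _ => ?_⟩
  obtain ⟨y, -, hy⟩ := isCompact_iff_ultrafilter_le_nhds.1 (isCompact_univ (X := Y)) (𝒰.map f)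
    (by simp)
  obtain ⟨hd, U, hyU, hUo, hfUo, H, hH⟩ := hf y
  have hU : f ⁻¹' U ∈ 𝒰 := hy (hUo.mem_nhds hyU)
  have : Finite (f ⁻¹' {y}) := hfin y
  have hcov : f ⁻¹' U ⊆ ⋃ i : f ⁻¹' {y}, {x | ∃ h : x ∈ f ⁻¹' U, (H ⟨x, h⟩).2 = i} := by
    intro x hx
    exact mem_iUnion.2 ⟨_, hx, rfl⟩
  obtain ⟨i, hi⟩ : ∃ i, {x | ∃ h : x ∈ f ⁻¹' U, (H ⟨x, h⟩).2 = i} ∈ 𝒰 := by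
    have := Filter.mem_of_superset hU hcov
    rw [← biUnion_univ] at this
    obtain ⟨i, -, hi⟩ := (Ultrafilter.finite_biUnion_mem_iff finite_univ).1 this
    exact ⟨i, hi⟩
  -- the section through the sheet that carries the ultrafilter
  let s : Y → X := fun z => if hz : z ∈ U then (H.symm (⟨z, hz⟩, i)).1 else i.1
  refine ⟨s y, mem_univ _, ?_⟩
  have hsc : ContinuousAt s y := by
    have : ContinuousOn s U := by
      rw [continuousOn_iff_continuous_domRestrict]
      have : U.domRestrict s = fun z : U => (H.symm (z, i)).1 := by
        ext z; simp [s]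
      rw [this]
      fun_prop
    exact this.continuousAt (hUo.mem_nhds hyU)
  have h1 : Filter.Tendsto (fun x => s (f x)) 𝒰 (𝓝 (s y)) := hsc.tendsto.comp hy
  have h2 : (fun x => s (f x)) =ᶠ[(𝒰 : Filter X)] id := by
    filter_upwards [hi] with x ⟨hx, hxi⟩
    have h3 : H ⟨x, hx⟩ = (⟨f x, hx⟩, i) := Prod.ext (Subtype.ext (hH ⟨x, hx⟩)) hxi
    have h4 : f x ∈ U := hx
    simp only [s, h4, dif_pos, ← h3, Homeomorph.symm_apply_apply, id]
  exact (Filter.tendsto_congr' h2).1 h1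

/-! ### Finite generation of the fundamental group -/

namespace Path.Homotopic.Quotient

variable {X : Type*} [TopologicalSpace X]

/-- The homotopy class `q` has a representative inside the set `U`. -/
def IsIn (U : Set X) {x y : X} (q : Path.Homotopic.Quotient x y) : Prop :=
  ∃ γ : Path x y, (∀ t, γ t ∈ U) ∧ Path.Homotopic.Quotient.mk γ = q

variable {U : Set X} {x y z : X}

theorem IsIn.trans {q : Path.Homotopic.Quotient x y} {r : Path.Homotopic.Quotient y z}
    (hq : IsIn U q) (hr : IsIn U r) : IsIn U (q.trans r) := by
  obtain ⟨γ, hγ, rfl⟩ := hq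
  obtain ⟨δ, hδ, rfl⟩ := hr
  refine ⟨γ.trans δ, fun t => ?_, rfl⟩
  have h : γ.trans δ t ∈ range (γ.trans δ) := mem_range_self t
  rw [Path.trans_range] at h
  rcases h with ⟨s, hs⟩ | ⟨s, hs⟩
  · exact hs ▸ hγ s
  · exact hs ▸ hδ s

theorem IsIn.symm {q : Path.Homotopic.Quotient x y} (hq : IsIn U q) : IsIn U q.symm := by
  obtain ⟨γ, hγ, rfl⟩ := hq
  exact ⟨γ.symm, fun t => hγ _, rfl⟩

theorem isIn_subpath {a b : X} (γ : Path a b) {s t : unitInterval} (hst : s ≤ t)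
    (h : ∀ r ∈ Icc s t, γ r ∈ U) : IsIn U (Path.Homotopic.Quotient.mk (γ.subpath s t)) := by
  refine ⟨_, fun r => ?_, rfl⟩
  have h1 : γ.subpath s t r ∈ range (γ.subpath s t) := mem_range_self r
  rw [Path.range_subpath_of_le _ _ _ hst] at h1
  obtain ⟨r', hr', h2⟩ := h1
  exact h2 ▸ h r' hr'

theorem mk_subpath_trans {a b : X} (γ : Path a b) (r s t : unitInterval) :
    (mk (γ.subpath r s)).trans (mk (γ.subpath s t)) = mk (γ.subpath r t) :=
  Quotient.sound ⟨Path.Homotopy.subpathTransSubpath γ r s t⟩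

end Path.Homotopic.Quotient

open Path.Homotopic.Quotient in
/-- The fundamental group of a compact, connected and locally path connected Hausdorff space `X` is
finitely generated if each point has an open neighborhood in which paths are determined, up to
homotopy in `X`, by their endpoints. For a finite cover by such neighborhoods `U i` and a finite set
`Q` of points that reaches the relevant components of the intersections `U i ∩ U j`, the generators
are the classes of paths that run inside some `U i` between two points of `Q`, closed up by fixed
paths `τ` to the base point. -/
theorem FundamentalGroup.fg_of_compactSpace {X : Type*} [TopologicalSpace X] [CompactSpace X]
    [T2Space X] [PathConnectedSpace X] [LocallyPathConnectedSpace X]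
    (hX : ∀ x : X, ∃ U : Set X, IsOpen U ∧ x ∈ U ∧ ∀ (y z : X) (q r : Path.Homotopic.Quotient y z),
      IsIn U q → IsIn U r → q = r) (b : X) : Group.FG (FundamentalGroup X b) := by
  choose U hUo hxU hU using hX
  -- a shrinking of the cover
  have hV : ∀ x, ∃ V : Set X, IsOpen V ∧ x ∈ V ∧ closure V ⊆ U x := fun x => by
    obtain ⟨V, hV, hVc, hVU⟩ := exists_mem_nhds_isClosed_subset ((hUo x).mem_nhds (hxU x))
    exact ⟨interior V, isOpen_interior, mem_interior_iff_mem_nhds.2 hV,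
      (closure_minimal interior_subset hVc).trans hVU⟩
  choose V hVo hxV hVU using hV
  obtain ⟨I, hI⟩ := isCompact_univ.elim_finite_subcover V hVo
    (fun x _ => mem_iUnion.2 ⟨x, hxV x⟩)
  have hcov : ∀ x, ∃ i ∈ I, x ∈ V i := fun x => by simpa using hI (mem_univ x)
  -- finitely many points that reach all of the intersections of two sets of the shrunk cover
  have hP : ∀ i j, ∃ P : Finset X, (∀ z ∈ V i ∩ V j, ∃ p ∈ P, JoinedIn (U i ∩ U j) p z) := by
    intro i j
    have hK : IsCompact (closure (V i) ∩ closure (V j)) :=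
      (isClosed_closure.inter isClosed_closure).isCompact
    have hKU : closure (V i) ∩ closure (V j) ⊆ U i ∩ U j := inter_subset_inter (hVU i) (hVU j)
    obtain ⟨P, -, hP⟩ := hK.elim_nhds_subcover (fun z => pathComponentIn (U i ∩ U j) z)
      (fun z hz => (((hUo i).inter (hUo j)).pathComponentIn z).mem_nhds
        (mem_pathComponentIn_self (hKU hz)))
    refine ⟨P, fun z hz => ?_⟩
    have := hP (inter_subset_inter subset_closure subset_closure hz)
    simp only [mem_iUnion] at this
    obtain ⟨p, hp, hpz⟩ := this
    exact ⟨p, hp, hpz⟩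
  choose P hP using hP
  classical
  let Q : Finset X := insert b (I.biUnion fun i => I.biUnion fun j => P i j)
  have hQ : ∀ i ∈ I, ∀ j ∈ I, ∀ z, z ∈ V i → z ∈ V j → ∃ p ∈ Q, ∃ e : Path.Homotopic.Quotient p z,
      IsIn (U i) e ∧ IsIn (U j) e := by
    intro i hi j hj z hzi hzj
    obtain ⟨p, hp, γ, hγ⟩ := hP i j z ⟨hzi, hzj⟩
    refine ⟨p, ?_, mk γ, ⟨γ, fun t => (hγ t).1, rfl⟩, ⟨γ, fun t => (hγ t).2, rfl⟩⟩
    simp only [Q, Finset.mem_insert, Finset.mem_biUnion]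
    exact Or.inr ⟨i, hi, j, hj, hp⟩
  let τ : ∀ p, Path.Homotopic.Quotient b p := fun p => mk (PathConnectedSpace.somePath b p)
  let S : Set (FundamentalGroup X b) :=
    {g | ∃ i ∈ I, ∃ p ∈ Q, ∃ p' ∈ Q, ∃ q : Path.Homotopic.Quotient p p', IsIn (U i) q ∧
      g = FundamentalGroup.fromPath (((τ p).trans q).trans (τ p').symm)}
  have hS : S.Finite := by
    have : S ⊆ ⋃ i ∈ I, ⋃ p ∈ Q, ⋃ p' ∈ Q, {g | ∃ q : Path.Homotopic.Quotient p p', IsIn (U i) q ∧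
      g = FundamentalGroup.fromPath (((τ p).trans q).trans (τ p').symm)} := by
      rintro g ⟨i, hi, p, hp, p', hp', q, hq, rfl⟩
      simp only [mem_iUnion]
      exact ⟨i, hi, p, hp, p', hp', q, hq, rfl⟩
    refine Set.Finite.subset ?_ this
    refine I.finite_toSet.biUnion fun i _ => Q.finite_toSet.biUnion fun p _ =>
      Q.finite_toSet.biUnion fun p' _ => Set.Subsingleton.finite ?_
    rintro _ ⟨q, hq, rfl⟩ _ ⟨r, hr, rfl⟩
    rw [hU i _ _ q r hq hr]
  let H : Subgroup (FundamentalGroup X b) := Subgroup.closure S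
  have hgen : ∀ i ∈ I, ∀ p ∈ Q, ∀ p' ∈ Q, ∀ q : Path.Homotopic.Quotient p p', IsIn (U i) q →
      FundamentalGroup.fromPath (((τ p).trans q).trans (τ p').symm) ∈ H :=
    fun i hi p hp p' hp' q hq => Subgroup.subset_closure ⟨i, hi, p, hp, p', hp', q, hq, rfl⟩
  have hmul : ∀ (p p' p'' : X) (q : Path.Homotopic.Quotient p p')
      (r : Path.Homotopic.Quotient p' p''),
      FundamentalGroup.fromPath (((τ p).trans q).trans (τ p').symm) ∈ H →
      FundamentalGroup.fromPath (((τ p').trans r).trans (τ p'').symm) ∈ H →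
      FundamentalGroup.fromPath (((τ p).trans (q.trans r)).trans (τ p'').symm) ∈ H := by
    intro p p' p'' q r hq hr
    have := H.mul_mem hr hq
    rw [FundamentalGroup.mul_def] at this
    convert this using 1
    change _ = (((τ p).trans q).trans (τ p').symm).trans (((τ p').trans r).trans (τ p'').symm)
    simp only [trans_assoc]
    rw [← trans_assoc (τ p').symm (τ p'), symm_trans, refl_trans]
  -- each piece of a loop, prolonged inside the cover to points of `Q`, gives an element of `H`
  have main : ∀ γ : Path b b, ∀ i ∈ I, ∀ j ∈ I, γ 0 ∈ V i → γ 1 ∈ V j → ∀ p ∈ Q, ∀ p' ∈ Q,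
      ∀ (a : Path.Homotopic.Quotient p (γ 0)) (c : Path.Homotopic.Quotient (γ 1) p'),
      IsIn (U i) a → IsIn (U j) c → FundamentalGroup.fromPath
        (((τ p).trans ((a.trans (mk (γ.subpath 0 1))).trans c)).trans (τ p').symm) ∈ H := by
    intro γ
    refine unitInterval.rel_zero_one_of_local (R := fun s t =>
      ∀ i ∈ I, ∀ j ∈ I, γ s ∈ V i → γ t ∈ V j → ∀ p ∈ Q, ∀ p' ∈ Q,
      ∀ (a : Path.Homotopic.Quotient p (γ s)) (c : Path.Homotopic.Quotient (γ t) p'),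
      IsIn (U i) a → IsIn (U j) c → FundamentalGroup.fromPath
        (((τ p).trans ((a.trans (mk (γ.subpath s t))).trans c)).trans (τ p').symm) ∈ H) ?_ ?_
    · intro r s t _ _ hrs hst i hi j hj hri htj p hp p' hp' a c ha hc
      obtain ⟨k, hk, hsk⟩ := hcov (γ s)
      obtain ⟨w, hw, e, he, -⟩ := hQ k hk k hk (γ s) hsk hsk
      have h := hmul _ _ _ _ _ (hrs i hi k hk hri hsk p hp w hw a e.symm ha he.symm)
        (hst k hk j hj hsk htj w hw p' hp' e c he hc)
      convert h using 4
      rw [← mk_subpath_trans γ r s t]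
      simp only [trans_assoc]
      rw [← trans_assoc e.symm e, symm_trans, refl_trans]
    · intro u
      obtain ⟨k, hk, huk⟩ := hcov (γ u)
      refine ⟨γ ⁻¹' V k, γ.continuous.continuousAt.preimage_mem_nhds ((hVo k).mem_nhds huk), ?_⟩
      intro s t hst hsub i hi j hj hsi htj p hp p' hp' a c ha hc
      obtain ⟨w, hw, e, hei, hek⟩ := hQ i hi k hk (γ s) hsi (hsub ⟨le_rfl, hst⟩)
      obtain ⟨w', hw', e', hej', hek'⟩ := hQ j hj k hk (γ t) htj (hsub ⟨hst, le_rfl⟩)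
      have hγ : IsIn (U k) (mk (γ.subpath s t)) :=
        isIn_subpath γ hst fun r hr => hVU k (subset_closure (hsub hr))
      have h1 := hgen i hi p hp w hw (a.trans e.symm) (ha.trans hei.symm)
      have h2 := hgen k hk w hw w' hw' ((e.trans (mk (γ.subpath s t))).trans e'.symm)
        ((hek.trans hγ).trans hek'.symm)
      have h3 := hgen j hj w' hw' p' hp' (e'.trans c) (hej'.trans hc)
      have h := hmul _ _ _ _ _ (hmul _ _ _ _ _ h1 h2) h3
      convert h using 4
      simp only [trans_assoc]
      rw [← trans_assoc e.symm e, symm_trans, refl_trans, ← trans_assoc e'.symm e', symm_trans,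
        refl_trans]
  have hloop : ∀ q : Path.Homotopic.Quotient b b,
      FundamentalGroup.fromPath (((τ b).trans q).trans (τ b).symm) ∈ H := by
    intro q
    obtain ⟨γ, rfl⟩ := mk_surjective q
    obtain ⟨i, hi, hbi⟩ := hcov b
    have hconst : ∀ {x y : X} (hx : x = b) (hy : y = b),
        IsIn (U i) ((refl b).cast hx hy) := by
      rintro x y rfl rfl
      exact ⟨Path.refl _, fun t => hVU i (subset_closure hbi), rfl⟩
    have hbQ : b ∈ Q := Finset.mem_insert_self _ _
    have h := main γ i hi i hi (by simpa using hbi) (by simpa using hbi) b hbQ b hbQ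
      ((refl b).cast rfl γ.source) ((refl b).cast γ.target rfl) (hconst _ _) (hconst _ _)
    have hc : ∀ {x y : X} (hx : x = b) (hy : y = b) (q : Path.Homotopic.Quotient b b),
        (((refl b).cast rfl hx).trans (q.cast hx hy)).trans ((refl b).cast hy rfl) = q := by
      rintro x y rfl rfl q
      simp
    rw [Path.subpath_zero_one, mk_cast, hc] at h
    exact h
  -- conjugation by the class `τ b`, which need not be trivial, is surjective
  have htop : H = ⊤ := by
    rw [eq_top_iff]
    intro g _
    have h := hloop (((τ b).symm.trans (FundamentalGroup.toPath g)).trans (τ b))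
    convert h using 1
    simp only [trans_assoc, trans_symm, trans_refl]
    rw [← trans_assoc, trans_symm, refl_trans]
  exact Group.fg_def.2 ((Subgroup.fg_iff _).2 ⟨S, htop, hS⟩)

open Path.Homotopic.Quotient in
/-- In a manifold, paths in a chart ball are determined up to homotopy by their endpoints. -/
theorem exists_isOpen_forall_isIn_eq (m : ℕ) {B : Type*} [TopologicalSpace B]
    [ChartedSpace (EuclideanSpace ℝ (Fin m)) B] (b : B) :
    ∃ U : Set B, IsOpen U ∧ b ∈ U ∧ ∀ (y z : B) (q r : Path.Homotopic.Quotient y z),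
      IsIn U q → IsIn U r → q = r := by
  set e := chartAt (EuclideanSpace ℝ (Fin m)) b
  have hb : b ∈ e.source := mem_chart_source _ b
  obtain ⟨r, hr, hball⟩ := Metric.isOpen_iff.1 e.open_target (e b) (e.map_source hb)
  set D := Metric.ball (e b) r
  have hc : ContractibleSpace D :=
    (convex_ball (e b) r).contractibleSpace ⟨e b, Metric.mem_ball_self hr⟩
  have hh : D ≃ₜ e.symm '' D := e.symm.homeomorphOfImageSubsetSource hball rfl
  have hs : SimplyConnectedSpace (e.symm '' D) := by
    have : ContractibleSpace (e.symm '' D) := hh.contractibleSpace_iff.1 hc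
    infer_instance
  refine ⟨e.symm '' D, e.symm.isOpen_image_of_subset_source Metric.isOpen_ball hball,
    ⟨e b, Metric.mem_ball_self hr, e.left_inv hb⟩, ?_⟩
  rintro y z _ _ ⟨γ, hγ, rfl⟩ ⟨δ, hδ, rfl⟩
  have hy : y ∈ e.symm '' D := γ.source ▸ hγ 0
  have hz : z ∈ e.symm '' D := γ.target ▸ hγ 1
  let γ' : Path (⟨y, hy⟩ : e.symm '' D) ⟨z, hz⟩ :=
    ⟨⟨fun t => ⟨γ t, hγ t⟩, by fun_prop⟩, Subtype.ext γ.source, Subtype.ext γ.target⟩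
  let δ' : Path (⟨y, hy⟩ : e.symm '' D) ⟨z, hz⟩ :=
    ⟨⟨fun t => ⟨δ t, hδ t⟩, by fun_prop⟩, Subtype.ext δ.source, Subtype.ext δ.target⟩
  have h := (SimplyConnectedSpace.paths_homotopic γ' δ').map ⟨Subtype.val, continuous_subtype_val⟩
  exact Path.Homotopic.Quotient.eq.2 h

/-! ### Coordinates adapted to the fibration and to the foliation -/

theorem finrank_euclidean_complex (q : ℕ) :
    Module.finrank ℝ (EuclideanSpace ℂ (Fin q)) = 2 * q := by
  rw [← Module.finrank_mul_finrank ℝ ℂ (EuclideanSpace ℂ (Fin q))]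
  simp

theorem OpenPartialHomeomorph.MDifferentiable.of_contMDiffOn {𝕜 E H M E' H' M' : Type*}
    [NontriviallyNormedField 𝕜]
    [NormedAddCommGroup E] [NormedSpace 𝕜 E] [TopologicalSpace H] {I : ModelWithCorners 𝕜 E H}
    [TopologicalSpace M] [ChartedSpace H M]
    [NormedAddCommGroup E'] [NormedSpace 𝕜 E'] [TopologicalSpace H'] {I' : ModelWithCorners 𝕜 E' H'}
    [TopologicalSpace M'] [ChartedSpace H' M'] {e : OpenPartialHomeomorph M M'}
    (h : ContMDiffOn I I' ∞ e e.source) (h' : ContMDiffOn I' I ∞ e.symm e.target) :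
    e.MDifferentiable I I' :=
  ⟨h.mdifferentiableOn (by simp), h'.mdifferentiableOn (by simp)⟩

section Fibration

variable {N m k : ℕ} {E B F : Type*}
    [TopologicalSpace E] [ChartedSpace (EuclideanSpace ℝ (Fin N)) E]
    [TopologicalSpace B] [ChartedSpace (EuclideanSpace ℝ (Fin m)) B]
    [TopologicalSpace F] [ChartedSpace (EuclideanSpace ℂ (Fin k)) F] {π : E → B}

theorem IsSmoothFibration.contMDiff (hπ : IsSmoothFibration N m k F π) :
    ContMDiff (𝓡 N) (𝓡 m) ∞ π := by
  intro x
  obtain ⟨e, hb, he, -⟩ := hπ (π x)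
  have hx : x ∈ e.source := e.mem_source.2 hb
  have h1 : ContMDiffAt (𝓡 N) (𝓡 m) ∞ (fun w => (e w).1) x :=
    contMDiffAt_fst.comp x (he.contMDiffAt (e.open_source.mem_nhds hx))
  refine h1.congr_of_eventuallyEq ?_
  filter_upwards [e.open_source.mem_nhds hx] with w hw
  exact (e.coe_fst hw).symm

theorem IsSmoothFibration.finrank_eq (hπ : IsSmoothFibration N m k F π) (x : E) :
    N = m + 2 * k := by
  obtain ⟨e, hb, he, he'⟩ := hπ (π x)
  have hx : x ∈ e.source := e.mem_source.2 hb
  have hd := OpenPartialHomeomorph.MDifferentiable.of_contMDiffOn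
    (e := e.toOpenPartialHomeomorph) he he'
  have := (hd.mfderiv hx).toLinearEquiv.finrank_eq
  have h1 : Module.finrank ℝ (EuclideanSpace ℝ (Fin N)) =
    Module.finrank ℝ (EuclideanSpace ℝ (Fin m) × EuclideanSpace ℂ (Fin k)) := this
  rwa [Module.finrank_prod, finrank_euclidean_complex, finrank_euclideanSpace_fin,
    finrank_euclideanSpace_fin] at h1

theorem IsSmoothFibration.mfderiv_surjective (hπ : IsSmoothFibration N m k F π) (x : E) :
    Function.Surjective (mfderiv (𝓡 N) (𝓡 m) π x) := by
  obtain ⟨e, hb, he, he'⟩ := hπ (π x)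
  have hx : x ∈ e.source := e.mem_source.2 hb
  have hd := OpenPartialHomeomorph.MDifferentiable.of_contMDiffOn
    (e := e.toOpenPartialHomeomorph) he he'
  have h1 : π =ᶠ[𝓝 x] fun w => (e w).1 := by
    filter_upwards [e.open_source.mem_nhds hx] with w hw
    exact (e.coe_fst hw).symm
  have h2 : HasMFDerivAt (𝓡 N) (𝓡 m) (fun w => (e w).1) x
      ((ContinuousLinearMap.fst ℝ _ _).comp
        (mfderiv (𝓡 N) ((𝓡 m).prod 𝓘(ℝ, EuclideanSpace ℂ (Fin k))) e x)) :=
    (hasMFDerivAt_fst (e x)).comp x (hd.mdifferentiableAt hx).hasMFDerivAt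
  rw [h1.mfderiv_eq, h2.mfderiv]
  intro v
  obtain ⟨w, hw⟩ := hd.mfderiv_surjective hx (v, 0)
  exact ⟨w, congrArg Prod.fst hw⟩

end Fibration

namespace TransHolFoliation

variable {p q N m k : ℕ} {E B F : Type*}
    [TopologicalSpace E] [ChartedSpace (EuclideanSpace ℝ (Fin N)) E]
    [TopologicalSpace B] [ChartedSpace (EuclideanSpace ℝ (Fin m)) B]
    [TopologicalSpace F] [ChartedSpace (EuclideanSpace ℂ (Fin k)) F] {π : E → B}
    {𝓕 : TransHolFoliation p q N E}
    {φ : OpenPartialHomeomorph E (EuclideanSpace ℝ (Fin p) × EuclideanSpace ℂ (Fin q))}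

theorem mdifferentiable (hφ : φ ∈ 𝓕.atlas) :
    φ.MDifferentiable (𝓡 N) 𝓘(ℝ, EuclideanSpace ℝ (Fin p) × EuclideanSpace ℂ (Fin q)) :=
  .of_contMDiffOn (𝓕.smooth φ hφ) (𝓕.smooth_symm φ hφ)

theorem finrank_eq (𝓕 : TransHolFoliation p q N E) (x : E) : N = p + 2 * q := by
  obtain ⟨φ, hφ, hx⟩ := 𝓕.covers x
  have h1 : Module.finrank ℝ (EuclideanSpace ℝ (Fin N)) =
    Module.finrank ℝ (EuclideanSpace ℝ (Fin p) × EuclideanSpace ℂ (Fin q)) :=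
    ((mdifferentiable hφ).mfderiv hx).toLinearEquiv.finrank_eq
  rwa [Module.finrank_prod, finrank_euclidean_complex, finrank_euclideanSpace_fin,
    finrank_euclideanSpace_fin] at h1

theorem mfderiv_transverse (hφ : φ ∈ 𝓕.atlas) {x : E} (hx : x ∈ φ.source) :
    mfderiv (𝓡 N) 𝓘(ℝ, EuclideanSpace ℂ (Fin q)) (fun w => (φ w).2) x =
      (ContinuousLinearMap.snd ℝ (EuclideanSpace ℝ (Fin p)) (EuclideanSpace ℂ (Fin q))).comp
        (mfderiv (𝓡 N) 𝓘(ℝ, EuclideanSpace ℝ (Fin p) × EuclideanSpace ℂ (Fin q)) φ x) := by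
  have h1 := ((mdifferentiable hφ).mdifferentiableAt hx).hasMFDerivAt
  have h2 : HasMFDerivAt 𝓘(ℝ, EuclideanSpace ℝ (Fin p) × EuclideanSpace ℂ (Fin q))
      𝓘(ℝ, EuclideanSpace ℂ (Fin q)) Prod.snd (φ x)
      (ContinuousLinearMap.snd ℝ (EuclideanSpace ℝ (Fin p)) (EuclideanSpace ℂ (Fin q))) :=
    hasFDerivAt_snd.hasMFDerivAt
  exact (h2.comp x h1).mfderiv

/-- Since the leaves and the fibers have complementary dimensions, transversality forces their
tangent spaces to meet in zero. -/
theorem IsTransverseTo.leafTangent_inf_ker (h𝓕 : 𝓕.IsTransverseTo m k π)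
    (hπ : IsSmoothFibration N m k F π) (hφ : φ ∈ 𝓕.atlas) {x : E} (hx : x ∈ φ.source) :
    leafTangent (N := N) φ x ⊓ LinearMap.ker (mfderiv (𝓡 N) (𝓡 m) π x).toLinearMap = ⊥ := by
  have : FiniteDimensional ℝ (TangentSpace (𝓡 N) x) :=
    inferInstanceAs (FiniteDimensional ℝ (EuclideanSpace ℝ (Fin N)))
  have hN : Module.finrank ℝ (TangentSpace (𝓡 N) x) = N :=
    finrank_euclideanSpace_fin (𝕜 := ℝ) (n := N)
  have h0 := Submodule.finrank_sup_add_finrank_inf_eq (leafTangent (N := N) φ x)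
    (LinearMap.ker (mfderiv (𝓡 N) (𝓡 m) π x).toLinearMap)
  have h1 := LinearMap.finrank_range_add_finrank_ker (mfderiv (𝓡 N) (𝓡 m) π x).toLinearMap
  have h2 := LinearMap.finrank_range_add_finrank_ker
    (mfderiv (𝓡 N) 𝓘(ℝ, EuclideanSpace ℂ (Fin q)) (fun w => (φ w).2) x).toLinearMap
  have h3 : LinearMap.range (mfderiv (𝓡 N) (𝓡 m) π x).toLinearMap = ⊤ :=
    LinearMap.range_eq_top.2 (hπ.mfderiv_surjective x)
  have h4 : LinearMap.range
      (mfderiv (𝓡 N) 𝓘(ℝ, EuclideanSpace ℂ (Fin q)) (fun w => (φ w).2) x).toLinearMap = ⊤ := by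
    rw [LinearMap.range_eq_top, mfderiv_transverse hφ hx]
    intro v
    obtain ⟨w, hw⟩ := (mdifferentiable hφ).mfderiv_surjective hx (0, v)
    exact ⟨w, congrArg Prod.snd hw⟩
  have hB : Module.finrank ℝ (TangentSpace (𝓡 m) (π x)) = m :=
    finrank_euclideanSpace_fin (𝕜 := ℝ) (n := m)
  have hC : Module.finrank ℝ
      (TangentSpace 𝓘(ℝ, EuclideanSpace ℂ (Fin q)) ((fun w => (φ w).2) x)) = 2 * q :=
    finrank_euclidean_complex q
  rw [h3, finrank_top, hB, hN] at h1
  rw [h4, finrank_top, hC, hN] at h2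
  rw [h𝓕.transverse x φ hφ hx, finrank_top, hN] at h0
  have h5 := hπ.finrank_eq x
  have h6 := 𝓕.finrank_eq x
  have h7 := h𝓕.dim_add
  have h8 : leafTangent (N := N) φ x = LinearMap.ker
    (mfderiv (𝓡 N) 𝓘(ℝ, EuclideanSpace ℂ (Fin q)) (fun w => (φ w).2) x).toLinearMap := rfl
  rw [← h8] at h2
  rw [← Submodule.finrank_eq_zero (R := ℝ)]
  omega

/-- By the inverse function theorem, `π` and the transverse coordinate of a foliation chart together
are a local homeomorphism onto `B × ℂ^q`; it is cut down so that its image is a product. -/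
theorem IsTransverseTo.exists_box [IsManifold (𝓡 m) ∞ B] (h𝓕 : 𝓕.IsTransverseTo m k π)
    (hπ : IsSmoothFibration N m k F π) (hφ : φ ∈ 𝓕.atlas) {x : E} (hx : x ∈ φ.source)
    {s : Set E} (hs : s ∈ 𝓝 x) :
    ∃ Ψ : OpenPartialHomeomorph E (B × EuclideanSpace ℂ (Fin q)),
      x ∈ Ψ.source ∧ Ψ.source ⊆ φ.source ∩ s ∧
      (∃ U W, IsOpen U ∧ IsOpen W ∧ Ψ.target = U ×ˢ W) ∧
      ∀ w ∈ Ψ.source, Ψ w = (π w, (φ w).2) := by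
  set χ := chartAt (EuclideanSpace ℝ (Fin m)) (π x) with hχ
  have hχx : π x ∈ χ.source := mem_chart_source _ _
  have hφd := mdifferentiable hφ
  have hχd : χ.MDifferentiable (𝓡 m) (𝓡 m) := mdifferentiable_chart (π x)
  have hx' : φ x ∈ φ.target := φ.map_source hx
  let g : EuclideanSpace ℝ (Fin p) × EuclideanSpace ℂ (Fin q) → EuclideanSpace ℝ (Fin m) :=
    fun v => χ (π (φ.symm v))
  have hgs : ContDiffAt ℝ ∞ g (φ x) := by
    rw [← contMDiffAt_iff_contDiffAt]
    have h1 := (𝓕.smooth_symm φ hφ).contMDiffAt (φ.open_target.mem_nhds hx')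
    have h2 : ContMDiffAt (𝓡 N) (𝓡 m) ∞ π (φ.symm (φ x)) := hπ.contMDiff _
    have h3 : ContMDiffAt (𝓡 m) (𝓡 m) ∞ χ (π (φ.symm (φ x))) := by
      rw [φ.left_inv hx]
      exact (contMDiffOn_chart (I := 𝓡 m) (n := ∞)).contMDiffAt (χ.open_source.mem_nhds hχx)
    exact h3.comp (φ x) (h2.comp (φ x) h1)
  let A := hφd.mfderiv hx
  let K := hχd.mfderiv hχx
  let D := mfderiv (𝓡 N) (𝓡 m) π x
  let g' : EuclideanSpace ℝ (Fin p) × EuclideanSpace ℂ (Fin q) →L[ℝ] EuclideanSpace ℝ (Fin m) :=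
    K.toContinuousLinearMap.comp (D.comp A.symm.toContinuousLinearMap)
  have hg : HasFDerivAt g g' (φ x) := by
    suffices h : HasMFDerivAt 𝓘(ℝ, EuclideanSpace ℝ (Fin p) × EuclideanSpace ℂ (Fin q)) (𝓡 m)
      g (φ x) g' from hasMFDerivAt_iff_hasFDerivAt.1 h
    have h1 := (hφd.mdifferentiableAt_symm hx').hasMFDerivAt
    have h2 : HasMFDerivAt (𝓡 N) (𝓡 m) π (φ.symm (φ x)) D := by
      rw [φ.left_inv hx]
      exact ((hπ.contMDiff x).mdifferentiableAt (by simp)).hasMFDerivAt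
    have h3 : HasMFDerivAt (𝓡 m) (𝓡 m) χ (π (φ.symm (φ x))) K.toContinuousLinearMap := by
      rw [φ.left_inv hx]
      exact (hχd.mdifferentiableAt hχx).hasMFDerivAt
    exact h3.comp (φ x) (h2.comp (φ x) h1)
  -- in the coordinates `φ` of the source, the second component of `(π, φ.2)` is the projection
  let G' := g'.prod (ContinuousLinearMap.snd ℝ (EuclideanSpace ℝ (Fin p))
    (EuclideanSpace ℂ (Fin q)))
  have hinj : Function.Injective G' := by
    rw [injective_iff_map_eq_zero]
    intro v hv
    have hv1 : K (D (A.symm v)) = 0 := congrArg Prod.fst hv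
    have hv2 : v.2 = 0 := congrArg Prod.snd hv
    have hw : A.symm v ∈ leafTangent (N := N) φ x ⊓
        LinearMap.ker (mfderiv (𝓡 N) (𝓡 m) π x).toLinearMap := by
      refine ⟨?_, ?_⟩
      · change mfderiv (𝓡 N) 𝓘(ℝ, EuclideanSpace ℂ (Fin q)) (fun w => (φ w).2) x (A.symm v) = 0
        rw [mfderiv_transverse hφ hx]
        have : A (A.symm v) = v := A.apply_symm_apply v
        exact (congrArg Prod.snd this).trans hv2
      · exact (map_eq_zero_iff K K.injective).1 hv1
    rw [h𝓕.leafTangent_inf_ker hπ hφ hx] at hw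
    exact (map_eq_zero_iff A.symm A.symm.injective).1 hw
  have hdim : Module.finrank ℝ (EuclideanSpace ℝ (Fin p) × EuclideanSpace ℂ (Fin q)) =
      Module.finrank ℝ (EuclideanSpace ℝ (Fin m) × EuclideanSpace ℂ (Fin q)) := by
    have h5 := hπ.finrank_eq x
    have h6 := 𝓕.finrank_eq x
    have h7 := h𝓕.dim_add
    rw [Module.finrank_prod, Module.finrank_prod, finrank_euclideanSpace_fin,
      finrank_euclideanSpace_fin]
    omega
  let L := (LinearEquiv.ofInjectiveOfFinrankEq (G' : _ →ₗ[ℝ] _) hinj hdim).toContinuousLinearEquiv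
  let G : EuclideanSpace ℝ (Fin p) × EuclideanSpace ℂ (Fin q) →
    EuclideanSpace ℝ (Fin m) × EuclideanSpace ℂ (Fin q) := fun v => (g v, v.2)
  have hGL : HasFDerivAt G (L : _ →L[ℝ] _) (φ x) := by
    have h1 : HasFDerivAt G G' (φ x) := hg.prodMk hasFDerivAt_snd
    have h2 : (L : _ →L[ℝ] _) = G' := by
      ext v <;> rfl
    rwa [h2]
  have hGs : ContDiffAt ℝ ∞ G (φ x) := hgs.prodMk contDiffAt_snd
  let Λ := hGs.toOpenPartialHomeomorph G hGL (by simp)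
  have hΛ : ∀ v, Λ v = G v := fun v => rfl
  have hΛx : φ x ∈ Λ.source := hGs.mem_toOpenPartialHomeomorph_source hGL (by simp)
  let Θ : OpenPartialHomeomorph E (B × EuclideanSpace ℂ (Fin q)) :=
    (φ.trans Λ).trans (χ.symm.prod (OpenPartialHomeomorph.refl _))
  have hΘ : ∀ w ∈ φ.source, π w ∈ χ.source → Θ w = (π w, (φ w).2) := by
    intro w hw hw'
    change (χ.symm (χ (π (φ.symm (φ w)))), (φ w).2) = _
    rw [φ.left_inv hw, χ.left_inv hw']
  have hΘx : x ∈ Θ.source := by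
    refine ⟨⟨hx, hΛx⟩, ?_⟩
    change (χ (π (φ.symm (φ x))), (φ x).2) ∈ χ.target ×ˢ univ
    rw [φ.left_inv hx]
    exact ⟨χ.map_source hχx, mem_univ _⟩
  -- shrink so that `Θ` is given by `(π, φ.2)` and its image is a product
  let S : Set E := Θ.source ∩ (π ⁻¹' χ.source ∩ interior s)
  have hSo : IsOpen S := Θ.open_source.inter
    ((χ.open_source.preimage hπ.contMDiff.continuous).inter isOpen_interior)
  have hxS : x ∈ S := ⟨hΘx, hχx, mem_interior_iff_mem_nhds.2 hs⟩
  have hSs : S ⊆ Θ.source := inter_subset_left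
  have himg : IsOpen (Θ '' S) := Θ.isOpen_image_of_subset_source hSo hSs
  obtain ⟨U, W, hU, hW, hxU, hxW, hUW⟩ := isOpen_prod_iff.1 himg (Θ x).1 (Θ x).2 ⟨x, hxS, rfl⟩
  have hφS : ∀ w ∈ S, w ∈ φ.source := fun w hw => hw.1.1.1
  let O : Set E := S ∩ Θ ⁻¹' (U ×ˢ W)
  have hO : IsOpen O := (Θ.continuousOn.mono hSs).isOpen_inter_preimage hSo (hU.prod hW)
  have hOs : O ⊆ Θ.source := inter_subset_left.trans hSs
  refine ⟨Θ.restrOpen O hO, ?_, ?_, ⟨U, W, hU, hW, ?_⟩, ?_⟩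
  · exact ⟨hΘx, hxS, hxU, hxW⟩
  · intro w hw
    exact ⟨hφS w hw.2.1, interior_subset hw.2.1.2.2⟩
  · ext v
    rw [OpenPartialHomeomorph.restrOpen]
    constructor
    · rintro ⟨hv, hv'⟩
      have : Θ (Θ.symm v) ∈ U ×ˢ W := hv'.2
      rwa [Θ.right_inv hv] at this
    · intro hv
      obtain ⟨w, hwS, rfl⟩ := hUW hv
      refine ⟨Θ.map_source (hSs hwS), ?_⟩
      change Θ.symm (Θ w) ∈ O
      rw [Θ.left_inv (hSs hwS)]
      exact ⟨hwS, hv⟩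
  · intro w hw
    exact hΘ w (hφS w hw.2.1) hw.2.1.2.1

end TransHolFoliation

/-! ### The leaf topology and transport between fibers -/

namespace TransHolFoliation

variable {p q N m k : ℕ} {E B F : Type*}
    [TopologicalSpace E] [ChartedSpace (EuclideanSpace ℝ (Fin N)) E]
    [TopologicalSpace B] [ChartedSpace (EuclideanSpace ℝ (Fin m)) B]
    {π : E → B} {𝓕 : TransHolFoliation p q N E}
    {φ ψ : OpenPartialHomeomorph E (EuclideanSpace ℝ (Fin p) × EuclideanSpace ℂ (Fin q))}

/-- A point of `E`, regarded as a point of the leaf space. -/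
def toLeafSpace (𝓕 : TransHolFoliation p q N E) (x : E) : 𝓕.LeafSpace := x

/-- A map that is continuous into `E` and stays in one plaque is continuous for the leaf topology. -/
theorem continuousAt_toLeafSpace_comp {X : Type*} [TopologicalSpace X] {f : X → E} {x₀ : X}
    (hφ : φ ∈ 𝓕.atlas) (hf : ContinuousAt f x₀) (hx : f x₀ ∈ φ.source)
    (hc : ∀ᶠ x in 𝓝 x₀, (φ (f x)).2 = (φ (f x₀)).2) :
    ContinuousAt (fun x => 𝓕.toLeafSpace (f x)) x₀ := by
  refine TopologicalSpace.tendsto_nhds_generateFrom_iff.2 ?_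
  rintro S ⟨φ', hφ', W, hW, y, rfl⟩ hS
  have hS1 : f x₀ ∈ φ'.source := hS.1
  have hS2 : (φ' (f x₀)).1 ∈ W := hS.2.1
  have hS3 : (φ' (f x₀)).2 = y := hS.2.2
  obtain ⟨g, -, hg⟩ := 𝓕.holomorphic φ hφ φ' hφ' (f x₀) ⟨hx, hS1⟩
  have h1 := hf.eventually hg
  have h2 := hf.eventually (φ'.open_source.mem_nhds hS1)
  have h3 : ∀ᶠ x in 𝓝 x₀, (φ' (f x)).1 ∈ W :=
    (continuous_fst.continuousAt.comp ((φ'.continuousAt hS1).comp hf)).eventually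
      (hW.mem_nhds hS2)
  filter_upwards [h1, h2, h3, hc] with x h1 h2 h3 hc
  refine ⟨h2, h3, ?_⟩
  change (φ' (f x)).2 = y
  rw [← hS3, h1, hc, ← hg.self_of_nhds]

theorem plaque_mem_nhds (hφ : φ ∈ 𝓕.atlas) {x : E} (hx : x ∈ φ.source)
    {W : Set (EuclideanSpace ℝ (Fin p))} (hW : IsOpen W) (hxW : (φ x).1 ∈ W) :
    {w : 𝓕.LeafSpace | w.toSpace ∈ φ.source ∧ (φ w.toSpace).1 ∈ W ∧ (φ w.toSpace).2 = (φ x).2} ∈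
      𝓝 (𝓕.toLeafSpace x) := by
  have h : IsOpen {w : 𝓕.LeafSpace |
      w.toSpace ∈ φ.source ∧ (φ w.toSpace).1 ∈ W ∧ (φ w.toSpace).2 = (φ x).2} :=
    TopologicalSpace.isOpen_generateFrom_of_mem ⟨φ, hφ, W, hW, (φ x).2, rfl⟩
  exact h.mem_nhds ⟨hx, hxW, rfl⟩

theorem continuous_toSpace : Continuous (LeafSpace.toSpace (𝓕 := 𝓕)) := by
  rw [continuous_iff_continuousAt]
  intro x O hO
  obtain ⟨φ, hφ, hx⟩ := 𝓕.covers x.toSpace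
  have hO' : ∀ᶠ v in 𝓝 (φ x.toSpace), φ.symm v ∈ O := by
    have := φ.continuousAt_symm (φ.map_source hx)
    rw [ContinuousAt, φ.left_inv hx] at this
    exact this hO
  have h2 : ∀ᶠ u in 𝓝 (φ x.toSpace).1, φ.symm (u, (φ x.toSpace).2) ∈ O :=
    (Continuous.prodMk_left (φ x.toSpace).2).continuousAt.eventually hO'
  obtain ⟨W, hWO, hW, hxW⟩ := eventually_nhds_iff.1 h2
  refine Filter.mem_of_superset (plaque_mem_nhds hφ hx hW hxW) ?_
  rintro w ⟨hw, hwW, hw2⟩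
  have := hWO _ hwW
  rw [← hw2] at this
  rwa [Prod.mk.eta, φ.left_inv hw] at this

theorem isOpen_leaf (𝓕 : TransHolFoliation p q N E) (x : E) :
    IsOpen {w : 𝓕.LeafSpace | w.toSpace ∈ 𝓕.leaf x} := by
  rw [isOpen_iff_mem_nhds]
  intro w hw
  obtain ⟨φ, hφ, hwφ⟩ := 𝓕.covers w.toSpace
  refine Filter.mem_of_superset (plaque_mem_nhds hφ hwφ isOpen_univ (mem_univ _)) ?_
  rintro z ⟨hz, -, hz2⟩
  exact Relation.EqvGen.trans _ _ _ hw (Relation.EqvGen.rel _ _ ⟨φ, hφ, hwφ, hz, hz2.symm⟩)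

theorem isClopen_leaf (𝓕 : TransHolFoliation p q N E) (x : E) :
    IsClopen {w : 𝓕.LeafSpace | w.toSpace ∈ 𝓕.leaf x} := by
  refine ⟨⟨?_⟩, 𝓕.isOpen_leaf x⟩
  rw [isOpen_iff_mem_nhds]
  intro w hw
  refine Filter.mem_of_superset ((𝓕.isOpen_leaf w.toSpace).mem_nhds (Relation.EqvGen.refl _)) ?_
  intro z hz hzx
  exact hw (Relation.EqvGen.trans _ _ _ hzx (Relation.EqvGen.symm _ _ hz))

open unitInterval

/-- A path in the leaf topology stays in one leaf, because leaves are open and closed. -/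
theorem mem_leaf_of_path (Γ : C(I, 𝓕.LeafSpace)) {x : E} (h0 : (Γ 0).toSpace ∈ 𝓕.leaf x) (t : I) :
    (Γ t).toSpace ∈ 𝓕.leaf x := by
  have h := ((𝓕.isClopen_leaf x).preimage Γ.continuous).eq_univ ⟨0, h0⟩
  exact (h ▸ mem_univ t : t ∈ Γ ⁻¹' _)

namespace IsTransverseTo

/-- Parallel transport along a homotopy class of paths from `b` to `b'`: the map from the fiber over
`b` to the fiber over `b'` obtained by lifting paths to the leaves. For loops this is
`IsTransverseTo.transport`. -/
noncomputable def parallel (h : 𝓕.IsTransverseTo m k π) {b b' : B}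
    (γ : Path.Homotopic.Quotient b b') (x : π ⁻¹' {b}) : π ⁻¹' {b'} :=
  let y := (h.covering x.1).monodromy γ ⟨⟨x.1, Relation.EqvGen.refl _⟩, x.2⟩
  ⟨y.1.1.toSpace, y.2⟩

variable (h : 𝓕.IsTransverseTo m k π) {b b' b'' : B}

theorem parallel_refl (x : π ⁻¹' {b}) : h.parallel (.refl b) x = x :=
  Subtype.ext <| congrArg (fun y => y.1.1.toSpace)
    (congrFun ((h.covering x.1).monodromy_refl (x := b)) ⟨⟨x.1, Relation.EqvGen.refl _⟩, x.2⟩)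

theorem parallel_trans (γ : Path.Homotopic.Quotient b b') (δ : Path.Homotopic.Quotient b' b'')
    (x : π ⁻¹' {b}) : h.parallel (γ.trans δ) x = h.parallel δ (h.parallel γ x) := by
  apply Subtype.ext
  have h₁ := (h.covering x.1).monodromy_trans_apply γ δ ⟨⟨x.1, Relation.EqvGen.refl _⟩, x.2⟩
  refine (congrArg (fun y => y.1.1.toSpace) h₁).trans ?_
  have hz := ((h.covering x.1).monodromy γ ⟨⟨x.1, Relation.EqvGen.refl _⟩, x.2⟩).1.2
  have hST := (leaf_eq_of_mem hz).symm
  have key : ∀ {S T : Set E} (_ : S = T)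
      (hS : IsCoveringMap (fun y : {y : 𝓕.LeafSpace // y.toSpace ∈ S} => π y.1.toSpace))
      (hT : IsCoveringMap (fun y : {y : 𝓕.LeafSpace // y.toSpace ∈ T} => π y.1.toSpace))
      (z : 𝓕.LeafSpace) (hzS : z.toSpace ∈ S) (hzT : z.toSpace ∈ T) (hzb : π z.toSpace = b'),
      (hS.monodromy δ ⟨⟨z, hzS⟩, hzb⟩).1.1 = (hT.monodromy δ ⟨⟨z, hzT⟩, hzb⟩).1.1 := by
    rintro S T rfl hS hT z hzS hzT hzb
    rfl
  exact key hST (h.covering x.1) (h.covering (h.parallel γ x).1) _ hz (Relation.EqvGen.refl _)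
    (h.parallel γ x).2

theorem parallel_symm_parallel (γ : Path.Homotopic.Quotient b b') (x : π ⁻¹' {b}) :
    h.parallel γ.symm (h.parallel γ x) = x := by
  rw [← parallel_trans, Path.Homotopic.Quotient.trans_symm, parallel_refl]

theorem parallel_parallel_symm (γ : Path.Homotopic.Quotient b b') (x : π ⁻¹' {b'}) :
    h.parallel γ (h.parallel γ.symm x) = x := by
  rw [← parallel_trans, Path.Homotopic.Quotient.symm_trans, parallel_refl]

theorem parallel_mem_leaf (γ : Path.Homotopic.Quotient b b') (x : π ⁻¹' {b}) :
    (h.parallel γ x).1 ∈ 𝓕.leaf x.1 :=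
  ((h.covering x.1).monodromy γ ⟨⟨x.1, Relation.EqvGen.refl _⟩, x.2⟩).1.2

/-- Transport can be computed from any lift of the path that is continuous for the leaf
topology. -/
theorem parallel_mk_eq (γ : Path b b') (x : π ⁻¹' {b}) (Γ : C(I, 𝓕.LeafSpace))
    (h0 : (Γ 0).toSpace = x.1) (hΓ : ∀ t, π (Γ t).toSpace = γ t) :
    (h.parallel (.mk γ) x).1 = (Γ 1).toSpace := by
  have hmem := mem_leaf_of_path Γ (x := x.1) (h0 ▸ Relation.EqvGen.refl _)
  let Γ' : C(I, 𝓕.Leaf x.1) := ⟨fun t => ⟨Γ t, hmem t⟩, by fun_prop⟩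
  have h1 := ((h.covering x.1).eq_liftPath_iff' (γ := γ) (e := ⟨x.1, Relation.EqvGen.refl _⟩)
    (γ.source.trans x.2.symm) (Γ := Γ')).2 ⟨funext hΓ, Subtype.ext h0⟩
  exact congrArg (fun Δ : C(I, 𝓕.Leaf x.1) => (Δ 1).1.toSpace) h1.symm

theorem exists_lift (h : 𝓕.IsTransverseTo m k π) (γ : Path b b') (x : π ⁻¹' {b}) : ∃ Γ : C(I, 𝓕.LeafSpace),
    (Γ 0).toSpace = x.1 ∧ ∀ t, π (Γ t).toSpace = γ t := by
  obtain ⟨Γ, hΓ, h0⟩ := (h.covering x.1).exists_path_lifts γ ⟨x.1, Relation.EqvGen.refl _⟩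
    (γ.source.trans x.2.symm)
  exact ⟨⟨fun t => (Γ t).1, by fun_prop⟩, congrArg (fun w : 𝓕.Leaf x.1 => w.1.toSpace) h0,
    fun t => congrFun hΓ t⟩

end IsTransverseTo

/-- A box adapted to the fibration `π` and to the foliation chart `φ`: a homeomorphism of an open
subset of the domain of `φ` onto a product of open sets of `B` and of `ℂ^q`, whose components are
`π` and the transverse coordinate of `φ`. -/
structure IsBox (π : E → B)
    (φ : OpenPartialHomeomorph E (EuclideanSpace ℝ (Fin p) × EuclideanSpace ℂ (Fin q)))
    (Ψ : OpenPartialHomeomorph E (B × EuclideanSpace ℂ (Fin q))) : Prop where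
  source_subset : Ψ.source ⊆ φ.source
  target_eq : ∃ U W, IsOpen U ∧ IsOpen W ∧ Ψ.target = U ×ˢ W
  apply_eq : ∀ w ∈ Ψ.source, Ψ w = (π w, (φ w).2)

namespace IsBox

variable {Ψ : OpenPartialHomeomorph E (B × EuclideanSpace ℂ (Fin q))} {b b' : B}

theorem mk_mem_target (hΨ : IsBox π φ Ψ) {x x' : E} (hx : x ∈ Ψ.source) (hx' : x' ∈ Ψ.source) :
    (π x, (φ x').2) ∈ Ψ.target := by
  obtain ⟨U, W, -, -, hUW⟩ := hΨ.target_eq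
  have h1 := Ψ.map_source hx
  have h2 := Ψ.map_source hx'
  rw [hΨ.apply_eq x hx, hUW] at h1
  rw [hΨ.apply_eq x' hx', hUW] at h2
  rw [hUW]
  exact ⟨h1.1, h2.2⟩

theorem apply_symm (hΨ : IsBox π φ Ψ) {v : B × EuclideanSpace ℂ (Fin q)} (hv : v ∈ Ψ.target) :
    (π (Ψ.symm v), (φ (Ψ.symm v)).2) = v := by
  rw [← hΨ.apply_eq _ (Ψ.map_target hv), Ψ.right_inv hv]

theorem symm_mk (hΨ : IsBox π φ Ψ) {x : E} (hx : x ∈ Ψ.source) :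
    Ψ.symm (π x, (φ x).2) = x := by
  rw [← hΨ.apply_eq x hx, Ψ.left_inv hx]

/-- Inside a box, transport moves a point along the slice on which the transverse coordinate is
constant. -/
theorem parallel_mk_eq (hΨ : IsBox π φ Ψ) (hφ : φ ∈ 𝓕.atlas) (h : 𝓕.IsTransverseTo m k π)
    (γ : Path b b') (x : π ⁻¹' {b}) (hx : x.1 ∈ Ψ.source) (hγ : ∀ t, γ t ∈ π '' Ψ.source) :
    (h.parallel (.mk γ) x).1 = Ψ.symm (b', (φ x.1).2) := by
  have hmem : ∀ t, (γ t, (φ x.1).2) ∈ Ψ.target := by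
    intro t
    obtain ⟨w, hw, hwt⟩ := hγ t
    exact hwt ▸ hΨ.mk_mem_target hw hx
  have hc : Continuous fun t => 𝓕.toLeafSpace (Ψ.symm (γ t, (φ x.1).2)) := by
    rw [continuous_iff_continuousAt]
    intro t
    refine continuousAt_toLeafSpace_comp hφ ?_ (hΨ.source_subset (Ψ.map_target (hmem t))) ?_
    · exact (Ψ.continuousAt_symm (hmem t)).comp
        (f := fun t => (γ t, (φ x.1).2)) (by fun_prop)
    · refine Filter.Eventually.of_forall fun s => ?_
      exact (congrArg Prod.snd (hΨ.apply_symm (hmem s))).trans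
        (congrArg Prod.snd (hΨ.apply_symm (hmem t))).symm
  have h1 := h.parallel_mk_eq γ x ⟨_, hc⟩ (by
      change Ψ.symm (γ 0, (φ x.1).2) = x.1
      have hxb : π x.1 = b := x.2
      have h2 := hΨ.symm_mk hx
      rw [hxb] at h2
      rw [γ.source, h2])
    (fun t => congrArg Prod.fst (hΨ.apply_symm (hmem t)))
  rw [h1]
  change Ψ.symm (γ 1, (φ x.1).2) = _
  rw [γ.target]

end IsBox

theorem IsTransverseTo.exists_isBox
    [TopologicalSpace F] [ChartedSpace (EuclideanSpace ℂ (Fin k)) F] [IsManifold (𝓡 m) ∞ B]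
    (h : 𝓕.IsTransverseTo m k π)
    (hπ : IsSmoothFibration N m k F π) (hφ : φ ∈ 𝓕.atlas) {x : E} (hx : x ∈ φ.source)
    {s : Set E} (hs : s ∈ 𝓝 x) :
    ∃ Ψ : OpenPartialHomeomorph E (B × EuclideanSpace ℂ (Fin q)),
      IsBox π φ Ψ ∧ x ∈ Ψ.source ∧ Ψ.source ⊆ s := by
  obtain ⟨Ψ, h1, h2, h3, h4⟩ := h.exists_box hπ hφ hx hs
  exact ⟨Ψ, ⟨h2.trans inter_subset_left, h3, h4⟩, h1, h2.trans inter_subset_right⟩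

/-- `PreservesAt φ T x`: the map `T` between two fibers of `π` is continuous at `x`, and it
preserves the transverse coordinate of `φ` near `x`. -/
def PreservesAt (φ : OpenPartialHomeomorph E (EuclideanSpace ℝ (Fin p) × EuclideanSpace ℂ (Fin q)))
    {b b' : B} (T : π ⁻¹' {b} → π ⁻¹' {b'}) (x : π ⁻¹' {b}) : Prop :=
  ContinuousAt T x ∧ ∀ᶠ y in 𝓝 x, (φ (T y).1).2 = (φ y.1).2

/-- `𝓕.HolAt T x`: the map `T` between two fibers of `π` is continuous at `x`, and in transverse
coordinates it is holomorphic near `x`. -/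
def HolAt (𝓕 : TransHolFoliation p q N E) {b b' : B} (T : π ⁻¹' {b} → π ⁻¹' {b'})
    (x : π ⁻¹' {b}) : Prop :=
  ContinuousAt T x ∧ ∀ φ ∈ 𝓕.atlas, x.1 ∈ φ.source → ∀ ψ ∈ 𝓕.atlas, (T x).1 ∈ ψ.source →
    ∃ f : EuclideanSpace ℂ (Fin q) → EuclideanSpace ℂ (Fin q),
      AnalyticAt ℂ f (φ x.1).2 ∧ ∀ᶠ y in 𝓝 x, (ψ (T y).1).2 = f (φ y.1).2

section

variable {A : Type*} {π : E → A} {b b' b'' : A} {T : π ⁻¹' {b} → π ⁻¹' {b'}} {T' : π ⁻¹' {b'} → π ⁻¹' {b''}}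
  {x : π ⁻¹' {b}}

theorem PreservesAt.comp (hT : PreservesAt φ T x) (hT' : PreservesAt φ T' (T x)) :
    PreservesAt φ (T' ∘ T) x := by
  refine ⟨hT'.1.comp hT.1, ?_⟩
  filter_upwards [hT.2, hT.1.eventually hT'.2] with y h1 h2
  exact h2.trans h1

theorem HolAt.comp (hT : 𝓕.HolAt T x) (hT' : 𝓕.HolAt T' (T x)) : 𝓕.HolAt (T' ∘ T) x := by
  refine ⟨hT'.1.comp hT.1, fun φ hφ hx ψ hψ hx' => ?_⟩
  obtain ⟨χ, hχ, hxχ⟩ := 𝓕.covers (T x).1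
  obtain ⟨f, hf, hfT⟩ := hT.2 φ hφ hx χ hχ hxχ
  obtain ⟨g, hg, hgT⟩ := hT'.2 χ hχ hxχ ψ hψ hx'
  refine ⟨g ∘ f, ?_, ?_⟩
  · rw [hfT.self_of_nhds] at hg
    exact hg.comp hf
  · filter_upwards [hfT, hT.1.eventually hgT] with y h1 h2
    rw [Function.comp_apply, Function.comp_apply, ← h1, ← h2]

theorem PreservesAt.holAt (hφ : φ ∈ 𝓕.atlas) (hT : PreservesAt φ T x) (hx : x.1 ∈ φ.source)
    (hx' : (T x).1 ∈ φ.source) : 𝓕.HolAt T x := by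
  refine ⟨hT.1, fun ψ hψ hxψ χ hχ hxχ => ?_⟩
  obtain ⟨g, hg, hgw⟩ := 𝓕.holomorphic ψ hψ φ hφ x.1 ⟨hxψ, hx⟩
  obtain ⟨g', hg', hgw'⟩ := 𝓕.holomorphic φ hφ χ hχ (T x).1 ⟨hx', hxχ⟩
  refine ⟨g' ∘ g, ?_, ?_⟩
  · rw [hT.2.self_of_nhds, hgw.self_of_nhds] at hg'
    exact hg'.comp hg
  · have h1 : ∀ᶠ y : π ⁻¹' {b} in 𝓝 x, (φ y.1).2 = g (ψ y.1).2 :=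
      continuous_subtype_val.continuousAt.eventually hgw
    have h2 : ∀ᶠ y in 𝓝 x, (χ (T y).1).2 = g' (φ (T y).1).2 :=
      (continuous_subtype_val.continuousAt.comp hT.1).eventually hgw'
    filter_upwards [h1, h2, hT.2] with y h1 h2 h3
    rw [h2, h3, h1, Function.comp_apply]

end

/-- Inside a box, transport preserves the transverse coordinate. -/
theorem IsBox.preservesAt {Ψ : OpenPartialHomeomorph E (B × EuclideanSpace ℂ (Fin q))} {b b' : B}
    (hΨ : IsBox π φ Ψ) (hφ : φ ∈ 𝓕.atlas) (h : 𝓕.IsTransverseTo m k π)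
    (γ : Path b b') (x : π ⁻¹' {b}) (hx : x.1 ∈ Ψ.source) (hγ : ∀ t, γ t ∈ π '' Ψ.source) :
    (h.parallel (.mk γ) x).1 ∈ Ψ.source ∧ PreservesAt φ (h.parallel (.mk γ)) x := by
  have hb' : b' ∈ π '' Ψ.source := γ.target ▸ hγ 1
  obtain ⟨w, hw, rfl⟩ := hb'
  have hmem : ∀ {y : E}, y ∈ Ψ.source → (π w, (φ y).2) ∈ Ψ.target :=
    fun hy => hΨ.mk_mem_target hw hy
  have hnear : ∀ᶠ y : π ⁻¹' {b} in 𝓝 x, y.1 ∈ Ψ.source :=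
    continuous_subtype_val.continuousAt.eventually (Ψ.open_source.mem_nhds hx)
  have heq : ∀ᶠ y : π ⁻¹' {b} in 𝓝 x,
      (h.parallel (.mk γ) y).1 = Ψ.symm (π w, (φ y.1).2) := by
    filter_upwards [hnear] with y hy
    exact hΨ.parallel_mk_eq hφ h γ y hy hγ
  refine ⟨?_, ?_, ?_⟩
  · rw [heq.self_of_nhds]
    exact Ψ.map_target (hmem hx)
  · rw [Topology.IsInducing.subtypeVal.continuousAt_iff]
    refine ContinuousAt.congr ?_ (heq.mono fun y hy => hy.symm)
    refine (Ψ.continuousAt_symm (hmem hx)).comp (f := fun y : π ⁻¹' {b} => (π w, (φ y.1).2)) ?_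
    exact continuousAt_const.prodMk (continuous_snd.continuousAt.comp
      ((φ.continuousAt (hΨ.source_subset hx)).comp continuous_subtype_val.continuousAt))
  · filter_upwards [heq, hnear] with y hy hyΨ
    rw [hy]
    exact (Prod.ext_iff.1 (hΨ.apply_symm (hmem hyΨ))).2

namespace IsTransverseTo

/-- Induction for transport maps: a property of pairs (map between fibers, point) that is stable
under composition holds for the transport along `γ` at `x` as soon as it holds, around every point
of the lift `Γ` of `γ` through `x`, for the transport along the paths that stay near this point. -/
theorem parallel_induction (h : 𝓕.IsTransverseTo m k π)
    {Q : ∀ b b' : B, (π ⁻¹' {b} → π ⁻¹' {b'}) → π ⁻¹' {b} → Prop}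
    (comp : ∀ (b b' b'' : B) (T : π ⁻¹' {b} → π ⁻¹' {b'}) (T' : π ⁻¹' {b'} → π ⁻¹' {b''})
      (x : π ⁻¹' {b}), Q b b' T x → Q b' b'' T' (T x) → Q b b'' (T' ∘ T) x)
    {b b' : B} (γ : Path b b') (x : π ⁻¹' {b}) (Γ : C(I, 𝓕.LeafSpace))
    (h0 : (Γ 0).toSpace = x.1) (hΓ : ∀ t, π (Γ t).toSpace = γ t)
    (loc : ∀ u, ∃ O ∈ 𝓝 (Γ u).toSpace, ∀ (c c' : B) (δ : Path c c') (y : π ⁻¹' {c}), y.1 ∈ O →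
      (∀ t, δ t ∈ π '' O) → Q c c' (h.parallel (.mk δ)) y) :
    Q b b' (h.parallel (.mk γ)) x := by
  have hpar : ∀ s t : I, h.parallel (.mk (γ.subpath s t)) ⟨(Γ s).toSpace, hΓ s⟩ =
      ⟨(Γ t).toSpace, hΓ t⟩ := by
    intro s t
    apply Subtype.ext
    have := h.parallel_mk_eq (γ.subpath s t) ⟨(Γ s).toSpace, hΓ s⟩
      (Γ.comp ⟨fun r => Set.Icc.convexComb s t r, by fun_prop⟩) (by simp)
      (fun r => hΓ _)
    rw [this]
    simp
  have key := unitInterval.rel_zero_one_of_local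
    (R := fun s t => Q _ _ (h.parallel (.mk (γ.subpath s t))) ⟨(Γ s).toSpace, hΓ s⟩)
    (by
      intro r s t _ _ hrs hst
      rw [← hpar r s] at hst
      have h1 := comp _ _ _ _ _ _ hrs hst
      convert h1 using 1
      funext y
      rw [Function.comp_apply, ← h.parallel_trans, Path.Homotopic.Quotient.mk_subpath_trans])
    (by
      intro u
      obtain ⟨O, hO, hQ⟩ := loc u
      refine ⟨(fun t => (Γ t).toSpace) ⁻¹' O,
        (continuous_toSpace.comp Γ.continuous).continuousAt.preimage_mem_nhds hO, ?_⟩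
      intro s t hst hsub
      refine hQ _ _ _ _ (hsub ⟨le_rfl, hst⟩) fun r => ?_
      have h1 : γ.subpath s t r ∈ range (γ.subpath s t) := mem_range_self r
      rw [Path.range_subpath_of_le _ _ _ hst] at h1
      obtain ⟨r', hr', h2⟩ := h1
      exact ⟨_, hsub hr', (hΓ r').trans h2⟩)
  have cast : ∀ {c c' : B} (hc : c = b) (hc' : c' = b') (q : Path.Homotopic.Quotient b b') (y : E)
      (hy : π y = c) (_ : y = x.1), Q c c' (h.parallel (q.cast hc hc')) ⟨y, hy⟩ →
      Q b b' (h.parallel q) x := by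
    rintro c c' rfl rfl q y hy hyx hQ
    have : (⟨y, hy⟩ : π ⁻¹' {c}) = x := Subtype.ext hyx
    rw [Path.Homotopic.Quotient.cast_rfl_rfl, this] at hQ
    exact hQ
  rw [Path.subpath_zero_one, Path.Homotopic.Quotient.mk_cast] at key
  exact cast _ _ _ _ _ h0 key

section

variable [TopologicalSpace F] [ChartedSpace (EuclideanSpace ℂ (Fin k)) F] [IsManifold (𝓡 m) ∞ B]
  {b b' : B}

/-- Transport maps between fibers are holomorphic in transverse coordinates. -/
theorem holAt_parallel (h : 𝓕.IsTransverseTo m k π) (hπ : IsSmoothFibration N m k F π)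
    (γ : Path.Homotopic.Quotient b b') (x : π ⁻¹' {b}) : 𝓕.HolAt (h.parallel γ) x := by
  obtain ⟨γ, rfl⟩ := Path.Homotopic.Quotient.mk_surjective γ
  obtain ⟨Γ, h0, hΓ⟩ := h.exists_lift γ x
  refine h.parallel_induction (Q := fun b b' T x => 𝓕.HolAt T x)
    (fun b b' b'' T T' x hT hT' => hT.comp hT') γ x Γ h0 hΓ fun u => ?_
  obtain ⟨φ, hφ, hu⟩ := 𝓕.covers (Γ u).toSpace
  obtain ⟨Ψ, hΨ, huΨ, -⟩ := h.exists_isBox hπ hφ hu Filter.univ_mem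
  refine ⟨Ψ.source, Ψ.open_source.mem_nhds huΨ, fun c c' δ y hy hδ => ?_⟩
  obtain ⟨h1, h2⟩ := hΨ.preservesAt hφ h δ y hy hδ
  exact h2.holAt hφ (hΨ.source_subset hy) (hΨ.source_subset h1)

/-- Two points of a plaque are related by the transport along the projection of a path in this
plaque, and this transport preserves the transverse coordinate also at the nearby points. -/
theorem exists_parallel_eq_of_samePlaque (h : 𝓕.IsTransverseTo m k π)
    (hπ : IsSmoothFibration N m k F π) (hφ : φ ∈ 𝓕.atlas)
    {x y : E} (hx : x ∈ φ.source) (hy : y ∈ φ.source) (hxy : (φ x).2 = (φ y).2) :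
    ∃ γ : Path.Homotopic.Quotient (π x) (π y), h.parallel γ ⟨x, rfl⟩ = ⟨y, rfl⟩ ∧
      PreservesAt φ (h.parallel γ) ⟨x, rfl⟩ := by
  obtain ⟨a, r, c, s, ht⟩ := 𝓕.target_eq φ hφ
  have hxt := φ.map_source hx
  have hyt := φ.map_source hy
  let l : I → EuclideanSpace ℝ (Fin p) × EuclideanSpace ℂ (Fin q) :=
    fun t => (AffineMap.lineMap (φ x).1 (φ y).1 (t : ℝ), (φ x).2)
  have hlc : Continuous l := by
    refine Continuous.prodMk ?_ continuous_const
    exact AffineMap.lineMap_continuous.comp continuous_subtype_val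
  have hl : ∀ t, l t ∈ φ.target := by
    intro t
    rw [ht] at hxt hyt ⊢
    exact ⟨(convex_ball a r).lineMap_mem hxt.1 hyt.1 t.2, hxt.2⟩
  have hl0 : φ.symm (l 0) = x := by
    have : l 0 = φ x := by simp [l]
    rw [this, φ.left_inv hx]
  have hl1 : φ.symm (l 1) = y := by
    have : l 1 = φ y := by simp [l, hxy]
    rw [this, φ.left_inv hy]
  have hsrc : ∀ t, φ.symm (l t) ∈ φ.source := fun t => φ.map_target (hl t)
  have hΓ : Continuous fun t => 𝓕.toLeafSpace (φ.symm (l t)) := by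
    rw [continuous_iff_continuousAt]
    intro t
    refine continuousAt_toLeafSpace_comp hφ
      ((φ.continuousAt_symm (hl t)).comp hlc.continuousAt) (hsrc t) ?_
    refine Filter.Eventually.of_forall fun t' => ?_
    rw [φ.right_inv (hl t'), φ.right_inv (hl t)]
  let Γ : C(I, 𝓕.LeafSpace) := ⟨_, hΓ⟩
  let γ : Path (π x) (π y) := ⟨⟨fun t => π (Γ t).toSpace,
    hπ.contMDiff.continuous.comp (continuous_toSpace.comp hΓ)⟩, congrArg π hl0, congrArg π hl1⟩
  refine ⟨.mk γ, ?_, ?_⟩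
  · exact Subtype.ext ((h.parallel_mk_eq γ ⟨x, rfl⟩ Γ hl0 fun t => rfl).trans hl1)
  · refine h.parallel_induction (Q := fun b b' T x => PreservesAt φ T x)
      (fun b b' b'' T T' x hT hT' => hT.comp hT') γ ⟨x, rfl⟩ Γ hl0 (fun t => rfl) fun u => ?_
    obtain ⟨Ψ, hΨ, huΨ, -⟩ := h.exists_isBox hπ hφ (hsrc u) Filter.univ_mem
    exact ⟨Ψ.source, Ψ.open_source.mem_nhds huΨ,
      fun c c' δ y hy hδ => (hΨ.preservesAt hφ h δ y hy hδ).2⟩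

theorem exists_parallel_eq_of_mem_leaf (h : 𝓕.IsTransverseTo m k π)
    (hπ : IsSmoothFibration N m k F π) {x y : E} (hxy : y ∈ 𝓕.leaf x) :
    ∃ γ : Path.Homotopic.Quotient (π x) (π y), h.parallel γ ⟨x, rfl⟩ = ⟨y, rfl⟩ := by
  change Relation.EqvGen 𝓕.SamePlaque x y at hxy
  induction hxy with
  | rel x y hxy =>
    obtain ⟨φ, hφ, hx, hy, hxy⟩ := hxy
    obtain ⟨γ, hγ, -⟩ := h.exists_parallel_eq_of_samePlaque hπ hφ hx hy hxy
    exact ⟨γ, hγ⟩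
  | refl x => exact ⟨.refl _, h.parallel_refl _⟩
  | symm x y _ ih =>
    obtain ⟨γ, hγ⟩ := ih
    exact ⟨γ.symm, by rw [← hγ, parallel_symm_parallel]⟩
  | trans x y z _ _ ih1 ih2 =>
    obtain ⟨γ, hγ⟩ := ih1
    obtain ⟨δ, hδ⟩ := ih2
    exact ⟨γ.trans δ, by rw [parallel_trans, hγ, hδ]⟩

end

end IsTransverseTo

end TransHolFoliation

/-! ### Transport as a holomorphic map -/

namespace TransHolFoliation

variable {p q N m k : ℕ} {E B F : Type*}
    [TopologicalSpace E] [ChartedSpace (EuclideanSpace ℝ (Fin N)) E]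
    [TopologicalSpace B] [ChartedSpace (EuclideanSpace ℝ (Fin m)) B]
    {π : E → B} {𝓕 : TransHolFoliation p q N E}
    {φ ψ : OpenPartialHomeomorph E (EuclideanSpace ℝ (Fin p) × EuclideanSpace ℂ (Fin q))}
    {Ψ : OpenPartialHomeomorph E (B × EuclideanSpace ℂ (Fin q))} {b b' : B}

namespace IsBox

theorem mk_mem_target_of_fiber (hΨ : IsBox π φ Ψ) {x : π ⁻¹' {b}} (hx : x.1 ∈ Ψ.source) :
    (b, (φ x.1).2) ∈ Ψ.target := by
  have hxb : π x.1 = b := x.2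
  have h := hΨ.mk_mem_target hx hx
  rwa [hxb] at h

theorem symm_mk_of_fiber (hΨ : IsBox π φ Ψ) {x : π ⁻¹' {b}} (hx : x.1 ∈ Ψ.source) :
    Ψ.symm (b, (φ x.1).2) = x.1 := by
  have hxb : π x.1 = b := x.2
  have h := hΨ.symm_mk hx
  rwa [hxb] at h

/-- In a box, the transverse coordinate is a chart of each fiber. -/
theorem eventually_of_eventually_fiber (hΨ : IsBox π φ Ψ) {x : π ⁻¹' {b}} (hx : x.1 ∈ Ψ.source)
    {P : π ⁻¹' {b} → Prop} (hP : ∀ᶠ y in 𝓝 x, P y) :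
    ∀ᶠ v in 𝓝 (φ x.1).2, (b, v) ∈ Ψ.target ∧
      ∀ hv : π (Ψ.symm (b, v)) = b, P ⟨Ψ.symm (b, v), hv⟩ := by
  have h1 := hΨ.mk_mem_target_of_fiber hx
  have hc : ContinuousAt (fun v => Ψ.symm (b, v)) (φ x.1).2 :=
    (Ψ.continuousAt_symm h1).comp (f := fun v => (b, v)) (by fun_prop)
  obtain ⟨S, hS, hSP⟩ := (mem_nhds_subtype _ _ _).1 hP
  have h2 : ∀ᶠ v in 𝓝 (φ x.1).2, Ψ.symm (b, v) ∈ S := by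
    refine hc.eventually (p := fun w => w ∈ S) ?_
    change ∀ᶠ w in 𝓝 (Ψ.symm (b, (φ x.1).2)), w ∈ S
    rw [hΨ.symm_mk_of_fiber hx]
    exact hS
  have h3 : ∀ᶠ v in 𝓝 (φ x.1).2, (b, v) ∈ Ψ.target :=
    (Continuous.prodMk_right b).continuousAt.eventually (Ψ.open_target.mem_nhds h1)
  filter_upwards [h2, h3] with v h2 h3
  exact ⟨h3, fun hv => hSP h2⟩

theorem eventually_fiber_of_eventually (hΨ : IsBox π φ Ψ) {x : π ⁻¹' {b}} (hx : x.1 ∈ Ψ.source)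
    {P : EuclideanSpace ℂ (Fin q) → Prop} (hP : ∀ᶠ v in 𝓝 (φ x.1).2, P v) :
    ∀ᶠ y : π ⁻¹' {b} in 𝓝 x, y.1 ∈ Ψ.source ∧ P (φ y.1).2 := by
  have h1 : ContinuousAt (fun y : π ⁻¹' {b} => (φ y.1).2) x :=
    continuous_snd.continuousAt.comp
      ((φ.continuousAt (hΨ.source_subset hx)).comp continuous_subtype_val.continuousAt)
  exact (continuous_subtype_val.continuousAt.eventually (Ψ.open_source.mem_nhds hx)).and
    (h1.eventually hP)

/-- Near a fixed point, a transport map of a fiber is described by a holomorphic map `f` of the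
transverse coordinate, and its fixed points are those of `f`. -/
theorem exists_analyticOnNhd_fixed_iff (hΨ : IsBox π φ Ψ) (hφ : φ ∈ 𝓕.atlas) {x : π ⁻¹' {b}}
    (hx : x.1 ∈ Ψ.source) {T : π ⁻¹' {b} → π ⁻¹' {b}} (hT : 𝓕.HolAt T x) (hTx : T x = x) :
    ∃ (f : EuclideanSpace ℂ (Fin q) → EuclideanSpace ℂ (Fin q)) (r : ℝ), 0 < r ∧
      AnalyticOnNhd ℂ f (Metric.ball (φ x.1).2 r) ∧
      ∀ v ∈ Metric.ball (φ x.1).2 r, (b, v) ∈ Ψ.target ∧ ∀ hv : π (Ψ.symm (b, v)) = b,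
        (T ⟨Ψ.symm (b, v), hv⟩ = ⟨Ψ.symm (b, v), hv⟩ ↔ f v = v) := by
  have hxφ := hΨ.source_subset hx
  obtain ⟨f, hf, hfT⟩ := hT.2 φ hφ hxφ φ hφ (by rw [hTx]; exact hxφ)
  have h1 : ∀ᶠ y in 𝓝 x, (T y).1 ∈ Ψ.source := by
    refine (continuous_subtype_val.continuousAt.comp hT.1).eventually
      (p := fun w => w ∈ Ψ.source) (Ψ.open_source.mem_nhds ?_)
    rw [Function.comp_apply, hTx]
    exact hx
  have h2 := hΨ.eventually_of_eventually_fiber hx (hfT.and h1)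
  obtain ⟨r₁, hr₁, hf₁⟩ := hf.exists_ball_analyticOnNhd
  obtain ⟨r₂, hr₂, hball⟩ := Metric.eventually_nhds_iff_ball.1 h2
  refine ⟨f, min r₁ r₂, lt_min hr₁ hr₂, hf₁.mono (Metric.ball_subset_ball (min_le_left _ _)), ?_⟩
  intro v hv
  obtain ⟨h3, h4⟩ := hball v (Metric.ball_subset_ball (min_le_right _ _) hv)
  refine ⟨h3, fun hvb => ?_⟩
  obtain ⟨h5, h6⟩ := h4 hvb
  have h7 : (φ (Ψ.symm (b, v))).2 = v := (Prod.ext_iff.1 (hΨ.apply_symm h3)).2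
  constructor
  · intro h
    rw [h] at h5
    change (φ (Ψ.symm (b, v))).2 = f (φ (Ψ.symm (b, v))).2 at h5
    rw [h7] at h5
    exact h5.symm
  · intro h
    apply Subtype.ext
    rw [← hΨ.symm_mk_of_fiber h6, h5]
    change Ψ.symm (b, f (φ (Ψ.symm (b, v))).2) = Ψ.symm (b, v)
    rw [h7, h]

end IsBox

/-- The analytic continuation principle for transport maps of a connected fiber. -/
theorem eq_self_of_eventually_eq_self [T2Space E] (hT : ∀ x : π ⁻¹' {b}, ∃ φ ∈ 𝓕.atlas, ∃ Ψ,
      IsBox π φ Ψ ∧ x.1 ∈ Ψ.source) [PreconnectedSpace (π ⁻¹' {b})]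
    {T : π ⁻¹' {b} → π ⁻¹' {b}} (hol : ∀ x, 𝓕.HolAt T x) {x₀ : π ⁻¹' {b}}
    (hx₀ : ∀ᶠ y in 𝓝 x₀, T y = y) (x : π ⁻¹' {b}) : T x = x := by
  have hTc : Continuous T := continuous_iff_continuousAt.2 fun x => (hol x).1
  have hfix : IsClosed {y | T y = y} := isClosed_eq hTc continuous_id
  let A : Set (π ⁻¹' {b}) := {x | ∀ᶠ y in 𝓝 x, T y = y}
  have hAfix : A ⊆ {y | T y = y} := fun x hx => hx.self_of_nhds
  have hAo : IsOpen A := isOpen_iff_mem_nhds.2 fun x hx => eventually_eventually_nhds.2 hx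
  have hAc : IsClosed A := by
    rw [← closure_subset_iff_isClosed]
    intro x hx
    have hTx : T x = x := closure_minimal hAfix hfix hx
    obtain ⟨φ, hφ, Ψ, hΨ, hxΨ⟩ := hT x
    obtain ⟨f, r, hr, hf, hfv⟩ := hΨ.exists_analyticOnNhd_fixed_iff hφ hxΨ (hol x) hTx
    have hnear := hΨ.eventually_fiber_of_eventually hxΨ (Metric.ball_mem_nhds (φ x.1).2 hr)
    obtain ⟨y, ⟨hyΨ, hyr⟩, hyA⟩ := mem_closure_iff_nhds.1 hx _ hnear
    have hyv := hΨ.eventually_of_eventually_fiber hyΨ hyA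
    have hid : f =ᶠ[𝓝 (φ y.1).2] id := by
      filter_upwards [hyv, Metric.isOpen_ball.mem_nhds hyr] with v hv hvr
      have hvb := (Prod.ext_iff.1 (hΨ.apply_symm hv.1)).1
      exact ((hfv v hvr).2 hvb).1 (hv.2 hvb)
    have hball := hf.eqOn_of_preconnected_of_eventuallyEq (analyticOnNhd_id)
      (convex_ball _ _).isPreconnected hyr hid
    refine Filter.mem_of_superset hnear ?_
    rintro z ⟨hzΨ, hzr⟩
    have h1 := hΨ.symm_mk_of_fiber hzΨ
    have h2 : π (Ψ.symm (b, (φ z.1).2)) = b := by rw [h1]; exact z.2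
    have h3 := ((hfv _ hzr).2 h2).2 (hball hzr)
    have h4 : (⟨Ψ.symm (b, (φ z.1).2), h2⟩ : π ⁻¹' {b}) = z := Subtype.ext h1
    rwa [h4] at h3
  have : A = univ := IsClopen.eq_univ ⟨hAc, hAo⟩ ⟨x₀, hx₀⟩
  exact hAfix (this ▸ mem_univ x)

open MeasureTheory in
/-- A transport map of a fiber that fixes a non-null set of points in a box is the identity near some
point of the fiber. -/
theorem IsBox.exists_eventually_eq_self_of_measure_ne_zero (hΨ : IsBox π φ Ψ) (hφ : φ ∈ 𝓕.atlas)
    {T : π ⁻¹' {b} → π ⁻¹' {b}} (hol : ∀ x, 𝓕.HolAt T x)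
    (ν : Measure (EuclideanSpace ℂ (Fin q))) [ν.IsAddHaarMeasure]
    (hpos : ν {v | (b, v) ∈ Ψ.target ∧ ∀ hv : π (Ψ.symm (b, v)) = b,
      T ⟨Ψ.symm (b, v), hv⟩ = ⟨Ψ.symm (b, v), hv⟩} ≠ 0) :
    ∃ x : π ⁻¹' {b}, ∀ᶠ y in 𝓝 x, T y = y := by
  set Z : Set (EuclideanSpace ℂ (Fin q)) := {v | (b, v) ∈ Ψ.target ∧
    ∀ hv : π (Ψ.symm (b, v)) = b, T ⟨Ψ.symm (b, v), hv⟩ = ⟨Ψ.symm (b, v), hv⟩} with hZ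
  obtain ⟨v, ⟨hvt, hvT⟩, hv⟩ := exists_mem_forall_mem_nhdsWithin_pos_measure hpos
  have hvb : π (Ψ.symm (b, v)) = b := (Prod.ext_iff.1 (hΨ.apply_symm hvt)).1
  have hv2 : (φ (Ψ.symm (b, v))).2 = v := (Prod.ext_iff.1 (hΨ.apply_symm hvt)).2
  obtain ⟨f, r, hr, hf, hfv⟩ := hΨ.exists_analyticOnNhd_fixed_iff hφ
    (x := ⟨Ψ.symm (b, v), hvb⟩) (Ψ.map_target hvt) (hol _) (hvT hvb)
  simp only [hv2] at hf hfv
  have hg : AnalyticOnNhd ℝ (fun w => f w - w) (Metric.ball v r) :=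
    (hf.sub analyticOnNhd_id).restrictScalars
  have hpos' : ν {w ∈ Metric.ball v r | f w - w = 0} ≠ 0 := by
    refine (lt_of_lt_of_le (hv _ (inter_mem_nhdsWithin Z (Metric.ball_mem_nhds v hr)))
      (measure_mono ?_)).ne'
    rintro w ⟨hw, hwr⟩
    have hwb := (Prod.ext_iff.1 (hΨ.apply_symm hw.1)).1
    exact ⟨hwr, sub_eq_zero.2 (((hfv w hwr).2 hwb).1 (hw.2 hwb))⟩
  obtain ⟨w, hwr, hw⟩ := hg.exists_eventuallyEq_zero_of_measure_ne_zero ν Metric.isOpen_ball hpos'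
  have hwt := (hfv w hwr).1
  have hwb : π (Ψ.symm (b, w)) = b := (Prod.ext_iff.1 (hΨ.apply_symm hwt)).1
  have hw2 : (φ (Ψ.symm (b, w))).2 = w := (Prod.ext_iff.1 (hΨ.apply_symm hwt)).2
  refine ⟨⟨Ψ.symm (b, w), hwb⟩, ?_⟩
  have hnear := hΨ.eventually_fiber_of_eventually (x := ⟨Ψ.symm (b, w), hwb⟩) (Ψ.map_target hwt)
    (P := fun v' => v' ∈ Metric.ball v r ∧ f v' - v' = 0) (by
      simp only [hw2]
      exact (Filter.eventually_of_mem (Metric.isOpen_ball.mem_nhds hwr) fun _ hv' => hv').and hw)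
  filter_upwards [hnear] with z hz
  obtain ⟨hzΨ, hzr, hz0⟩ := hz
  have h1 := hΨ.symm_mk_of_fiber hzΨ
  have h2 : π (Ψ.symm (b, (φ z.1).2)) = b := by rw [h1]; exact z.2
  have h3 := ((hfv _ hzr).2 h2).2 (sub_eq_zero.1 hz0)
  have h4 : (⟨Ψ.symm (b, (φ z.1).2), h2⟩ : π ⁻¹' {b}) = z := Subtype.ext h1
  rwa [h4] at h3

section Holonomy

variable [TopologicalSpace F] [ChartedSpace (EuclideanSpace ℂ (Fin k)) F] [IsManifold (𝓡 m) ∞ B]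

/-- The holonomy transport along a chain of plaques is the transport between fibers along the
projection to the base of a path in these plaques, read in transverse coordinates. -/
theorem HolonomyTransport.exists_parallel (h : 𝓕.IsTransverseTo m k π)
    (hπ : IsSmoothFibration N m k F π) {x z : E}
    {f : EuclideanSpace ℂ (Fin q) → EuclideanSpace ℂ (Fin q)}
    (H : 𝓕.HolonomyTransport φ x ψ z f) : ψ ∈ 𝓕.atlas ∧ z ∈ ψ.source ∧
      ∃ γ : Path.Homotopic.Quotient (π x) (π z), h.parallel γ ⟨x, rfl⟩ = ⟨z, rfl⟩ ∧
        ∀ᶠ y in 𝓝 (⟨x, rfl⟩ : π ⁻¹' {π x}), (ψ (h.parallel γ y).1).2 = f (φ y.1).2 := by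
  induction H with
  | refl hφ hx =>
    refine ⟨hφ, hx, .refl _, h.parallel_refl _, Filter.Eventually.of_forall fun y => ?_⟩
    rw [h.parallel_refl, id]
  | @plaque ψ z f z' _ hz' hzz' ih =>
    obtain ⟨hψ, hz, γ, hγ, hγf⟩ := ih
    obtain ⟨δ, hδ, hδψ⟩ := h.exists_parallel_eq_of_samePlaque hπ hψ hz hz' hzz'.symm
    refine ⟨hψ, hz', γ.trans δ, by rw [h.parallel_trans, hγ, hδ], ?_⟩
    have hc := (h.holAt_parallel hπ γ ⟨x, rfl⟩).1
    rw [ContinuousAt, hγ] at hc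
    filter_upwards [hγf, hc.eventually hδψ.2] with y h1 h2
    rw [h.parallel_trans, h2, h1]
  | @change ψ z f χ _ hχ hzχ ih =>
    obtain ⟨hψ, hz, γ, hγ, hγf⟩ := ih
    refine ⟨hχ, hzχ, γ, hγ, ?_⟩
    obtain ⟨g, -, hg⟩ := 𝓕.holomorphic ψ hψ χ hχ z ⟨hz, hzχ⟩
    have hc := (h.holAt_parallel hπ γ ⟨x, rfl⟩).1
    rw [ContinuousAt, hγ] at hc
    have h1 : ∀ᶠ y in 𝓝 (⟨x, rfl⟩ : π ⁻¹' {π x}),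
        (χ (h.parallel γ y).1).2 = g (ψ (h.parallel γ y).1).2 :=
      (continuous_subtype_val.continuousAt.tendsto.comp hc).eventually hg
    -- the transition map agrees with `g` near the transverse coordinate of `z`
    have hzt := ψ.map_source hz
    have hcs : ContinuousAt (fun v => ψ.symm ((ψ z).1, v)) (ψ z).2 :=
      (ψ.continuousAt_symm hzt).comp (f := fun v => ((ψ z).1, v)) (x := (ψ z).2) (by fun_prop)
    have hcs' : Filter.Tendsto (fun v => ψ.symm ((ψ z).1, v)) (𝓝 (ψ z).2) (𝓝 z) := by
      have := hcs.tendsto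
      rwa [Prod.mk.eta, ψ.left_inv hz] at this
    have hcm : ContinuousAt (fun v => ((ψ z).1, v)) (ψ z).2 := by fun_prop
    have h2 : ∀ᶠ v in 𝓝 (ψ z).2, transition ψ χ z v = g v := by
      filter_upwards [hcs'.eventually hg, hcm.eventually (ψ.open_target.mem_nhds hzt)]
        with v hv hvt
      rw [transition, hv, ψ.right_inv hvt]
    have h3 : Filter.Tendsto (fun y => (ψ (h.parallel γ y).1).2)
        (𝓝 (⟨x, rfl⟩ : π ⁻¹' {π x})) (𝓝 (ψ z).2) :=
      (continuous_snd.continuousAt.tendsto.comp (ψ.continuousAt hz).tendsto).comp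
        (continuous_subtype_val.continuousAt.tendsto.comp hc)
    filter_upwards [h1, hγf, h3.eventually h2] with y h1 h2 h3
    rw [h1, Function.comp_apply, ← h2, h3]

/-- The holonomy group of a leaf is finite if the global holonomy is, because a germ of holonomy at
`x` is determined by an element of the global holonomy group at `π x`. -/
theorem IsTransverseTo.finite_holonomyGroup (h : 𝓕.IsTransverseTo m k π)
    (hπ : IsSmoothFibration N m k F π) {x : E} (hφ : φ ∈ 𝓕.atlas) (hx : x ∈ φ.source)
    (hfin : Finite (h.globalHolonomy (π x))) : (𝓕.holonomyGroup φ x).Finite := by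
  have key : ∀ g ∈ 𝓕.holonomyGroup φ x, ∃ σ ∈ h.globalHolonomy (π x),
      ∃ f : EuclideanSpace ℂ (Fin q) → EuclideanSpace ℂ (Fin q),
        g = (f : Filter.Germ (𝓝 (φ x).2) (EuclideanSpace ℂ (Fin q))) ∧
        ∀ᶠ y in 𝓝 (⟨x, rfl⟩ : π ⁻¹' {π x}), (φ (σ y).1).2 = f (φ y.1).2 := by
    rintro g ⟨f, hf, rfl⟩
    obtain ⟨-, -, γ, -, hγ⟩ := hf.exists_parallel h hπ
    exact ⟨h.globalHolonomyHom (π x) γ, ⟨γ, rfl⟩, f, rfl, hγ⟩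
  choose! σ hσ hσf using key
  refine Set.Finite.of_injOn (f := σ) (t := (h.globalHolonomy (π x) : Set _))
    (fun g hg => hσ g hg) ?_
    (Set.toFinite _)
  intro g hg g' hg' hgg'
  obtain ⟨f, hgf, hf⟩ := hσf g hg
  obtain ⟨f', hgf', hf'⟩ := hσf g' hg'
  rw [hgf, hgf', Filter.Germ.coe_eq]
  obtain ⟨Ψ, hΨ, hxΨ, -⟩ := h.exists_isBox hπ hφ hx Filter.univ_mem
  have h1 : ∀ᶠ y in 𝓝 (⟨x, rfl⟩ : π ⁻¹' {π x}), f (φ y.1).2 = f' (φ y.1).2 := by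
    filter_upwards [hf, hf'] with y h1 h2
    rw [← h1, ← h2, hgg']
  filter_upwards [hΨ.eventually_of_eventually_fiber (x := ⟨x, rfl⟩) hxΨ h1] with v hv
  have h2 := hΨ.apply_symm hv.1
  have h3 := hv.2 (Prod.ext_iff.1 h2).1
  have h4 : (φ (Ψ.symm (π x, v))).2 = v := (Prod.ext_iff.1 h2).2
  change f (φ (Ψ.symm (π x, v))).2 = f' (φ (Ψ.symm (π x, v))).2 at h3
  rwa [h4] at h3

end Holonomy

end TransHolFoliation

/-! ### Null sets and finiteness of the global holonomy -/

open MeasureTheory in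
/-- The points whose transverse coordinate belongs to a null set form a null set. -/
theorem TransHolFoliation.measure_transverse_preimage_eq_zero {p q N : ℕ} {E : Type*}
    [TopologicalSpace E] [ChartedSpace (EuclideanSpace ℝ (Fin N)) E] [IsManifold (𝓡 N) ∞ E]
    [MeasurableSpace E] [BorelSpace E] {μ : Measure E} (hμ : IsVolumeMeasure N μ)
    {𝓕 : TransHolFoliation p q N E}
    {φ : OpenPartialHomeomorph E (EuclideanSpace ℝ (Fin p) × EuclideanSpace ℂ (Fin q))}
    (hφ : φ ∈ 𝓕.atlas) {O : Set E} (hO : IsOpen O) (hOφ : O ⊆ φ.source) (x : E)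
    (hOx : O ⊆ (chartAt (EuclideanSpace ℝ (Fin N)) x).source)
    (ν : Measure (EuclideanSpace ℂ (Fin q))) [ν.IsAddHaarMeasure]
    {T : Set (EuclideanSpace ℂ (Fin q))} (hT : ν T = 0) :
    μ {w ∈ O | (φ w).2 ∈ T} = 0 := by
  set e := chartAt (EuclideanSpace ℝ (Fin N)) x with he
  set T' := toMeasurable ν T
  have hT' : ν T' = 0 := (measure_toMeasurable T).trans hT
  have hT'm : MeasurableSet T' := measurableSet_toMeasurable ν T
  refine measure_mono_null (t := {w ∈ O | (φ w).2 ∈ T'})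
    (fun w hw => ⟨hw.1, subset_toMeasurable ν T hw.2⟩) ?_
  set S : Set E := {w ∈ O | (φ w).2 ∈ T'} with hS
  have hSm : MeasurableSet S := by
    have hc : Continuous fun w : O => (φ w.1).2 :=
      continuous_snd.comp (continuousOn_iff_continuous_domRestrict.1 (φ.continuousOn.mono hOφ))
    have : S = Subtype.val '' ((fun w : O => (φ w.1).2) ⁻¹' T') := by
      ext w
      simp [hS, and_comm]
    rw [this]
    exact hO.measurableSet.subtype_image (hc.measurable hT'm)
  obtain ⟨ρ, -, -, hρ⟩ := hμ e (chart_mem_atlas _ x)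
  rw [hρ S (fun w hw => hOx hw.1) hSm]
  refine setLIntegral_measure_zero _ _ ?_
  -- a linear identification of the two models
  have hdim : Module.finrank ℝ (EuclideanSpace ℝ (Fin N)) =
      Module.finrank ℝ (EuclideanSpace ℝ (Fin p) × EuclideanSpace ℂ (Fin q)) := by
    rw [Module.finrank_prod, finrank_euclidean_complex, finrank_euclideanSpace_fin,
      finrank_euclideanSpace_fin]
    exact 𝓕.finrank_eq x
  let L : EuclideanSpace ℝ (Fin N) ≃L[ℝ] EuclideanSpace ℝ (Fin p) × EuclideanSpace ℂ (Fin q) :=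
    (LinearEquiv.ofFinrankEq _ _ hdim).toContinuousLinearEquiv
  let D : Set (EuclideanSpace ℝ (Fin N)) := L ⁻¹' (φ '' S)
  have hnull : (volume : Measure (EuclideanSpace ℝ (Fin N))) D = 0 := by
    have h1 : ((volume : Measure (EuclideanSpace ℝ (Fin p))).prod ν)
        (Prod.snd ⁻¹' T') = 0 := by
      rw [Measure.measure_prod_null (measurable_snd hT'm)]
      exact Filter.Eventually.of_forall fun _ => hT'
    have h2 : ((volume : Measure (EuclideanSpace ℝ (Fin N))).map L) (Prod.snd ⁻¹' T') = 0 := by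
      have : ((volume : Measure (EuclideanSpace ℝ (Fin N))).map L).IsAddHaarMeasure :=
        L.isAddHaarMeasure_map volume
      have := Measure.prod.instIsAddHaarMeasure
        (volume : Measure (EuclideanSpace ℝ (Fin p))) ν
      exact Measure.absolutelyContinuous_isAddHaarMeasure _
        ((volume : Measure (EuclideanSpace ℝ (Fin p))).prod ν) h1
    rw [Measure.map_apply L.continuous.measurable (measurable_snd hT'm)] at h2
    refine measure_mono_null ?_ h2
    rintro v ⟨w, hw, hwv⟩
    change (L v).2 ∈ T'
    rw [← hwv]
    exact hw.2
  -- `G` is a differentiable change of charts that maps the null set `D` onto the image of `S`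
  let G : EuclideanSpace ℝ (Fin N) → EuclideanSpace ℝ (Fin N) := fun v => e (φ.symm (L v))
  have hG : DifferentiableOn ℝ G D := by
    rintro v ⟨w, hw, hwv⟩
    refine DifferentiableAt.differentiableWithinAt ?_
    have h1 : DifferentiableAt ℝ (fun u => e (φ.symm u)) (L v) := by
      rw [← hwv, ← mdifferentiableAt_iff_differentiableAt]
      have h2 := (mdifferentiable hφ).mdifferentiableAt_symm (φ.map_source (hOφ hw.1))
      have h3 : MDifferentiableAt (𝓡 N) (𝓡 N) e (φ.symm (φ w)) := by
        rw [φ.left_inv (hOφ hw.1)]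
        exact (mdifferentiable_chart x).mdifferentiableAt (hOx hw.1)
      exact h3.comp (φ w) h2
    exact h1.comp v L.differentiableAt
  refine measure_mono_null ?_
    (addHaar_image_eq_zero_of_differentiableOn_of_addHaar_eq_zero volume hG hnull)
  rintro _ ⟨w, hw, rfl⟩
  refine ⟨L.symm (φ w), ⟨w, hw, by simp⟩, ?_⟩
  simp only [G, L.apply_symm_apply, φ.left_inv (hOφ hw.1)]

namespace TransHolFoliation

variable {p q N m k : ℕ} {E B F : Type*}
    [TopologicalSpace E] [ChartedSpace (EuclideanSpace ℝ (Fin N)) E]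
    [TopologicalSpace B] [ChartedSpace (EuclideanSpace ℝ (Fin m)) B]
    {π : E → B} {𝓕 : TransHolFoliation p q N E}
    {φ : OpenPartialHomeomorph E (EuclideanSpace ℝ (Fin p) × EuclideanSpace ℂ (Fin q))}

theorem mem_compactLeaves_iff_of_mem_leaf {x y : E} (h : y ∈ 𝓕.leaf x) :
    y ∈ 𝓕.compactLeaves ↔ x ∈ 𝓕.compactLeaves := by
  change CompactSpace {z : 𝓕.LeafSpace // z.toSpace ∈ 𝓕.leaf y} ↔
    CompactSpace {z : 𝓕.LeafSpace // z.toSpace ∈ 𝓕.leaf x}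
  rw [leaf_eq_of_mem h]

namespace IsTransverseTo

variable (h : 𝓕.IsTransverseTo m k π) {b b' : B}

theorem surjective_on_leaf [PathConnectedSpace B] (h : 𝓕.IsTransverseTo m k π) (x : E) :
    Function.Surjective fun y : 𝓕.Leaf x => π y.1.toSpace := by
  intro b
  let γ : Path.Homotopic.Quotient (π x) b := .mk (PathConnectedSpace.somePath _ _)
  exact ⟨⟨(h.parallel γ ⟨x, rfl⟩).1, h.parallel_mem_leaf γ ⟨x, rfl⟩⟩, (h.parallel γ ⟨x, rfl⟩).2⟩

theorem compactSpace_base [PathConnectedSpace B] (h : 𝓕.IsTransverseTo m k π) {x : E}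
    (hx : x ∈ 𝓕.compactLeaves) : CompactSpace B := by
  have : CompactSpace (𝓕.Leaf x) := hx
  exact (h.surjective_on_leaf x).compactSpace (h.covering x).continuous

/-- The global holonomy has a finite orbit through a point of a compact leaf,
because the orbit lies in a fiber of the covering of `B` by this leaf. -/
theorem finite_orbit [T1Space B] {x : π ⁻¹' {b}} (hx : x.1 ∈ 𝓕.compactLeaves) :
    (range fun γ : FundamentalGroup B b => h.globalHolonomyHom b γ x).Finite := by
  have : CompactSpace (𝓕.Leaf x.1) := hx
  let f : 𝓕.Leaf x.1 → B := fun y => π y.1.toSpace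
  have hd : DiscreteTopology (f ⁻¹' {b}) := (h.covering x.1 b).discreteTopology_fiber
  have hfin : (f ⁻¹' {b}).Finite :=
    ((isClosed_singleton.preimage (h.covering x.1).continuous).isCompact).finite ⟨hd⟩
  refine Set.Finite.of_finite_image (f := Subtype.val)
    ((hfin.image fun y => y.1.toSpace).subset ?_) Subtype.val_injective.injOn
  rintro _ ⟨_, ⟨γ, rfl⟩, rfl⟩
  exact ⟨⟨(h.parallel γ x).1, h.parallel_mem_leaf γ x⟩, (h.parallel γ x).2, rfl⟩

/-- The stabilizer of a point of a compact leaf has finite index. -/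
theorem exists_finiteIndex_fixing [T1Space B] {x : π ⁻¹' {b}} (hx : x.1 ∈ 𝓕.compactLeaves) :
    ∃ H : Subgroup (FundamentalGroup B b), H.FiniteIndex ∧
      ∀ γ ∈ H, h.globalHolonomyHom b γ x = x := by
  let _ : MulAction (FundamentalGroup B b) (π ⁻¹' {b}) :=
    MulAction.compHom _ (h.globalHolonomyHom b)
  have hfin : Finite (MulAction.orbit (FundamentalGroup B b) x) := h.finite_orbit hx
  have : Finite (FundamentalGroup B b ⧸ MulAction.stabilizer (FundamentalGroup B b) x) :=
    Finite.of_equiv _ (MulAction.orbitEquivQuotientStabilizer (FundamentalGroup B b) x)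
  exact ⟨MulAction.stabilizer (FundamentalGroup B b) x,
    Subgroup.finiteIndex_of_finite_quotient, fun γ hγ => hγ⟩

theorem finite_globalHolonomy_of_path (γ : Path.Homotopic.Quotient b b')
    (hfin : Finite (h.globalHolonomy b)) : Finite (h.globalHolonomy b') := by
  let τ : π ⁻¹' {b} ≃ π ⁻¹' {b'} := ⟨h.parallel γ, h.parallel γ.symm,
    h.parallel_symm_parallel γ, h.parallel_parallel_symm γ⟩
  have hf : (h.globalHolonomy b : Set (Equiv.Perm (π ⁻¹' {b}))).Finite := Set.toFinite _
  refine ((hf.image fun σ => (τ.symm.trans σ).trans τ).subset ?_).to_subtype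
  rintro _ ⟨δ, rfl⟩
  refine ⟨_, ⟨FundamentalGroup.fromPath ((γ.trans (FundamentalGroup.toPath δ)).trans γ.symm), rfl⟩,
    ?_⟩
  ext x
  change (h.parallel γ (h.parallel ((γ.trans δ).trans γ.symm) (h.parallel γ.symm x))).1 =
    (h.parallel δ x).1
  rw [h.parallel_trans, h.parallel_parallel_symm, h.parallel_trans, h.parallel_parallel_symm]

section

variable [TopologicalSpace F] [ChartedSpace (EuclideanSpace ℂ (Fin k)) F] [IsManifold (𝓡 m) ∞ B]

/-- If the global holonomy is finite, then the fibers of the covering of `B` by a leaf are finite,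
being orbits of the global holonomy. -/
theorem compactSpace_leaf [CompactSpace B] (hπ : IsSmoothFibration N m k F π)
    (hfin : ∀ b, Finite (h.globalHolonomy b)) (x : E) : CompactSpace (𝓕.Leaf x) := by
  refine (h.covering x).compactSpace_of_finite_fibers fun b => ?_
  rcases Set.eq_empty_or_nonempty ((fun y : 𝓕.Leaf x => π y.1.toSpace) ⁻¹' {b}) with he | ⟨y, rfl⟩
  · rw [he]
    exact Set.finite_empty
  have := hfin (π y.1.toSpace)
  refine Set.Finite.of_finite_image (f := fun z : 𝓕.Leaf x => z.1.toSpace) (Set.Finite.subset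
    (Set.finite_range fun σ : h.globalHolonomy (π y.1.toSpace) => (σ.1 ⟨y.1.toSpace, rfl⟩).1) ?_)
    fun z _ z' _ hzz' => Subtype.ext hzz'
  rintro _ ⟨z, hz, rfl⟩
  have hz' : π z.1.toSpace = π y.1.toSpace := hz
  have hyz : z.1.toSpace ∈ 𝓕.leaf y.1.toSpace := by
    rw [leaf_eq_of_mem y.2]
    exact z.2
  obtain ⟨γ, hγ⟩ := h.exists_parallel_eq_of_mem_leaf hπ hyz
  have hcast : ∀ {c c' : B} (hc : c = c') (δ : Path.Homotopic.Quotient (π y.1.toSpace) c'),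
      (h.parallel (δ.cast rfl hc) ⟨y.1.toSpace, rfl⟩).1 =
        (h.parallel δ ⟨y.1.toSpace, rfl⟩).1 := by
    rintro c c' rfl δ
    rw [Path.Homotopic.Quotient.cast_rfl_rfl]
  refine ⟨⟨h.globalHolonomyHom _ (FundamentalGroup.fromPath (γ.cast rfl hz'.symm)), _, rfl⟩, ?_⟩
  exact (hcast hz'.symm γ).trans (congrArg Subtype.val hγ)

open MeasureTheory in
/-- If the compact leaves have positive measure, then `B` is compact and the global holonomy group
at some point `b` is finite: one of the countably many subgroups of finite index of `π₁(B, b)` fixes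
a non-null set of points of the fiber over `b`, and therefore acts trivially on this fiber. -/
theorem exists_finite_globalHolonomy [T2Space E] [SecondCountableTopology E]
    [IsManifold (𝓡 N) ∞ E] [MeasurableSpace E] [BorelSpace E] [T2Space B] [ConnectedSpace B]
    [ConnectedSpace F] (hπ : IsSmoothFibration N m k F π) {μ : Measure E}
    (hμ : IsVolumeMeasure N μ) (hpos : 0 < μ 𝓕.compactLeaves) :
    CompactSpace B ∧ ∃ b, Finite (h.globalHolonomy b) := by
  have : LocallyPathConnectedSpace B :=
    ChartedSpace.locallyPathConnectedSpace (EuclideanSpace ℝ (Fin m)) B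
  have : PathConnectedSpace B := PathConnectedSpace.of_locallyPathConnectedSpace
  obtain ⟨x, hx, hxpos⟩ := exists_mem_forall_mem_nhdsWithin_pos_measure hpos.ne'
  have hB : CompactSpace B := h.compactSpace_base hx
  refine ⟨hB, π x, ?_⟩
  set b := π x
  have hFG : Group.FG (FundamentalGroup B b) :=
    FundamentalGroup.fg_of_compactSpace (exists_isOpen_forall_isIn_eq m) b
  have hFc : PreconnectedSpace (π ⁻¹' {b}) := by
    obtain ⟨e, he, -⟩ := hπ b
    refine ⟨?_⟩
    rw [← (e.preimageSingletonHomeomorph he).symm.surjective.range_eq]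
    exact isPreconnected_range (e.preimageSingletonHomeomorph he).symm.continuous
  obtain ⟨φ, hφ, hxφ⟩ := 𝓕.covers x
  set e := chartAt (EuclideanSpace ℝ (Fin N)) x
  obtain ⟨Ψ, hΨ, hxΨ, hΨe⟩ := h.exists_isBox hπ hφ hxφ
    (e.open_source.mem_nhds (mem_chart_source _ x))
  let ν : Measure (EuclideanSpace ℂ (Fin q)) := Measure.addHaar
  -- the compact leaves meet the transversal in the box in a set of positive measure
  have hT : ν {v | (b, v) ∈ Ψ.target ∧ Ψ.symm (b, v) ∈ 𝓕.compactLeaves} ≠ 0 := by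
    intro h0
    refine (hxpos _ (inter_mem_nhdsWithin _ (Ψ.open_source.mem_nhds hxΨ))).ne' ?_
    refine measure_mono_null ?_
      (measure_transverse_preimage_eq_zero hμ hφ Ψ.open_source hΨ.source_subset x hΨe ν h0)
    rintro w ⟨hw, hwΨ⟩
    have hwt := hΨ.mk_mem_target hxΨ hwΨ
    refine ⟨hwΨ, hwt, ?_⟩
    refine (mem_compactLeaves_iff_of_mem_leaf ?_).2 hw
    exact Relation.EqvGen.rel _ _ ⟨φ, hφ, hΨ.source_subset hwΨ,
      hΨ.source_subset (Ψ.map_target hwt), (Prod.ext_iff.1 (hΨ.apply_symm hwt)).2.symm⟩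
  let Z : Subgroup (FundamentalGroup B b) → Set (EuclideanSpace ℂ (Fin q)) := fun H =>
    {v | (b, v) ∈ Ψ.target ∧ ∀ hv : π (Ψ.symm (b, v)) = b, ∀ γ ∈ H,
      h.globalHolonomyHom b γ ⟨Ψ.symm (b, v), hv⟩ = ⟨Ψ.symm (b, v), hv⟩}
  obtain ⟨H, hH, hHpos⟩ : ∃ H : Subgroup (FundamentalGroup B b), H.FiniteIndex ∧ ν (Z H) ≠ 0 := by
    by_contra! hcon
    refine hT (measure_mono_null ?_ ((measure_biUnion_null_iff
      (Group.countable_finiteIndex_subgroup (FundamentalGroup B b))).2 hcon))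
    rintro v ⟨hvt, hvc⟩
    have hvb := (Prod.ext_iff.1 (hΨ.apply_symm hvt)).1
    obtain ⟨H, hH, hHf⟩ := h.exists_finiteIndex_fixing (x := ⟨Ψ.symm (b, v), hvb⟩) hvc
    exact mem_biUnion hH ⟨hvt, fun _ => hHf⟩
  have hker : H ≤ (h.globalHolonomyHom b).ker := by
    intro γ hγ
    have hol := h.holAt_parallel hπ γ
    have hZ : Z H ⊆ {v | (b, v) ∈ Ψ.target ∧ ∀ hv : π (Ψ.symm (b, v)) = b,
        h.parallel γ ⟨Ψ.symm (b, v), hv⟩ = ⟨Ψ.symm (b, v), hv⟩} :=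
      fun v hv => ⟨hv.1, fun hvb => hv.2 hvb γ hγ⟩
    obtain ⟨y, hy⟩ := hΨ.exists_eventually_eq_self_of_measure_ne_zero hφ hol ν
      (fun h0 => hHpos (measure_mono_null hZ h0))
    rw [MonoidHom.mem_ker]
    ext z
    refine congrArg Subtype.val (eq_self_of_eventually_eq_self (fun z => ?_) hol hy z)
    obtain ⟨φ', hφ', hz⟩ := 𝓕.covers z.1
    obtain ⟨Ψ', hΨ', hzΨ', -⟩ := h.exists_isBox hπ hφ' hz Filter.univ_mem
    exact ⟨φ', hφ', Ψ', hΨ', hzΨ'⟩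
  have : (h.globalHolonomyHom b).ker.FiniteIndex := Subgroup.finiteIndex_of_le hker
  exact Finite.of_equiv _ (QuotientGroup.quotientKerEquivRange (h.globalHolonomyHom b)).toEquiv

end

end IsTransverseTo

end TransHolFoliation

theorem theorem2 {p q N m k : ℕ} {E B F : Type*}
    [TopologicalSpace E] [T2Space E] [SecondCountableTopology E] [ConnectedSpace E]
    [ChartedSpace (EuclideanSpace ℝ (Fin N)) E] [IsManifold (𝓡 N) ∞ E]
    [MeasurableSpace E] [BorelSpace E]
    [TopologicalSpace B] [T2Space B] [SecondCountableTopology B] [ConnectedSpace B]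
    [ChartedSpace (EuclideanSpace ℝ (Fin m)) B] [IsManifold (𝓡 m) ∞ B]
    [TopologicalSpace F] [T2Space F] [SecondCountableTopology F] [ConnectedSpace F]
    [ChartedSpace (EuclideanSpace ℂ (Fin k)) F]
    [IsManifold 𝓘(ℂ, EuclideanSpace ℂ (Fin k)) ω F]
    (π : E → B) (hπ : IsSmoothFibration N m k F π)
    (𝓕 : TransHolFoliation p q N E) (h𝓕 : 𝓕.IsTransverseTo m k π)
    (μ : MeasureTheory.Measure E) (hμ : IsVolumeMeasure N μ)
    (hpos : 0 < μ 𝓕.compactLeaves) :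
    𝓕.IsSeifertFibration ∧ ∀ b : B, Finite (h𝓕.globalHolonomy b) := by
  have : LocallyPathConnectedSpace B :=
    ChartedSpace.locallyPathConnectedSpace (EuclideanSpace ℝ (Fin m)) B
  have : PathConnectedSpace B := PathConnectedSpace.of_locallyPathConnectedSpace
  obtain ⟨hB, b, hb⟩ := h𝓕.exists_finite_globalHolonomy hπ hμ hpos
  have hfin : ∀ b', Finite (h𝓕.globalHolonomy b') := fun b' =>
    h𝓕.finite_globalHolonomy_of_path (.mk (PathConnectedSpace.somePath b b')) hb
  exact ⟨fun x => ⟨h𝓕.compactSpace_leaf hπ hfin x,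
    fun φ hφ hx => h𝓕.finite_holonomyGroup hπ hφ hx (hfin (π x))⟩, hfin⟩
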